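/- **Theorem.** Let $\mathbf k$ be a commutative ring and let $H$ be a quasitriangular Hopf algebra over $\mathbf k$ with coproduct $\Delta$, counit $\varepsilon$, antipode $\gamma$ and universal R-matrix $\mathcal R=\mathcal R_1\otimes\mathcal R_2\in H\otimes H$ (summation suppressed). Thus $\mathcal R$ is invertible, $(\Delta\otimes\mathrm{id})(\mathcal R)=\mathcal R_{13}\mathcal R_{23}$, $(\mathrm{id}\otimes\Delta)(\mathcal R)=\mathcal R_{13}\mathcal R_{12}$, and $\mathcal R\,\Delta(x)=\Delta^{op}(x)\,\mathcal R$ for all $x\in H$. Let $H^*$ be a dual of $H$, meaning one of the following: * the full linear dual $\mathrm{Hom}_{\mathbf k}(H,\mathbf k)$ with the transposed bialgebra structure, when $H$ is finitely generated and projective over $\mathbf k$; * for arbitrary $H$, any bialgebra over $\mathbf k$ with a bialgebra pairing $\langle\cdot,\cdot\rangle\colon H^*\otimes H\to\mathbf k$, that is, $\langle ab,x\rangle=\langle a,x_{(1)}\rangle\langle b,x_{(2)}\rangle$, $\langle 1,x\rangle=\varepsilon(x)$, $\langle a,xy\rangle=\langle a_{(1)},x\rangle\langle a_{(2)},y\rangle$,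 $\langle a,1\rangle=\varepsilon_{H^*}(a)$. For $x,y\in H$ and $a\in H^*$ put $x\triangleright a=a_{(1)}\langle a_{(2)},x\rangle$, $a\triangleleft x=\langle a_{(1)},x\rangle a_{(2)}$ and $(x\otimes y)\blacktriangleright a=y\triangleright a\triangleleft\gamma(x)$. *The RE dual.* $\tilde H^*$ is the $\mathbf k$-module $H^*$ with the same unit, the action $x\blacktriangleright a=\Delta(x)\blacktriangleright a$ of $H$, and the multiplication $$a\circ b=(\mathcal F_1\blacktriangleright a)(\mathcal F_2\blacktriangleright b),\qquad \mathcal F=\mathcal R_{13}\mathcal R_{23}\in (H\otimes H)\otimes(H\otimes H),$$ where the product on the right is that of $H^*$. *Twisted tensor powers.* For $H$-module algebras $\mathcal A,\mathcal B$, the algebra $\mathcal A\,\tilde\otimes\,\mathcal B$ is the $\mathbf k$-module $\mathcal A\otimes\mathcal B$ with unit $1\otimes 1$, the action of $H$ through $\Delta$, and the multiplication $$(a_1\otimes b_1)(a_2\otimes b_2)=a_1(\mathcal R_2\blacktriangleright a_2)\otimes(\mathcal R_1\blacktriangleright b_1)b_2 .$$ Put $(\tilde H^*)^{\tilde\otimes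 0}=\mathbf k$ (with $H$ acting through $\varepsilon$), $(\tilde H^*)^{\tilde\otimes 1}=\tilde H^*$ and $(\tilde H^*)^{\tilde\otimes n}=(\tilde H^*)^{\tilde\otimes (n-1)}\,\tilde\otimes\,\tilde H^*$ for $n\ge 2$. Then for every $n\in\mathbb N=\{0,1,2,\dots\}$, $\tilde H^*$ and $(\tilde H^*)^{\tilde\otimes n}$ are associative unital left $H$-module algebras, and the $n$-fold coproduct $\Delta^n_{H^*}\colon H^*\to (H^*)^{\otimes n}$ (with $\Delta^0=\varepsilon_{H^*}$, $\Delta^1=\mathrm{id}$, $\Delta^2=\Delta_{H^*}$, $\Delta^{n+1}=(\Delta^{n}\otimes\mathrm{id})\circ\Delta_{H^*}$ for $n\ge1$), regarded as a $\mathbf k$-linear map $\tilde H^*\to(\tilde H^*)^{\tilde\otimes n}$, is an $H$-equivariant homomorphism of unital algebras. In particular ($n=0,2$), the counit $\tilde H^*\to\mathbf k$ and the coproduct $\tilde H^*\to\tilde H^*\,\tilde\otimes\,\tilde H^*$ are $H$-equivariant algebra homomorphisms, so $\tilde H^*$ is a braided bialgebra (Majid). -/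

import Mathlib

open scoped TensorProduct

universe u

noncomputable section

namespace REDual

section RMatrix

variable {k : Type u} [CommRing k] {H : Type u} [Ring H] [HopfAlgebra k H]

/-- `x ⊗ y ↦ x ⊗ y ⊗ 1`. -/
def leg12 : H ⊗[k] H →ₐ[k] H ⊗[k] (H ⊗[k] H) :=
  Algebra.TensorProduct.map (AlgHom.id k H) Algebra.TensorProduct.includeLeft

/-- `x ⊗ y ↦ x ⊗ 1 ⊗ y`. -/
def leg13 : H ⊗[k] H →ₐ[k] H ⊗[k] (H ⊗[k] H) :=
  Algebra.TensorProduct.map (AlgHom.id k H) Algebra.TensorProduct.includeRight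

/-- `x ⊗ y ↦ 1 ⊗ x ⊗ y`. -/
def leg23 : H ⊗[k] H →ₐ[k] H ⊗[k] (H ⊗[k] H) :=
  Algebra.TensorProduct.includeRight

/-- `R` is a universal R-matrix of the Hopf algebra `H`, that is, `(H, R)` is quasitriangular:
`R` is invertible, `(Δ ⊗ id)(R) = R₁₃ R₂₃`, `(id ⊗ Δ)(R) = R₁₃ R₁₂` and
`R Δ(x) = Δᵒᵖ(x) R` for all `x`. -/
structure IsUniversalRMatrix (R : H ⊗[k] H) : Prop where
  isUnit : IsUnit R
  comul_left : TensorProduct.assoc k H H H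
    ((Coalgebra.comul (R := k) (A := H)).rTensor H R) = leg13 R * leg23 R
  comul_right : (Coalgebra.comul (R := k) (A := H)).lTensor H R = leg13 R * leg12 R
  comul_op : ∀ x : H, R * Coalgebra.comul (R := k) x =
    TensorProduct.comm k H H (Coalgebra.comul (R := k) x) * R

end RMatrix

section ModuleAlgebras

/-- The map `x ⊗ y ↦ α(x) ⊗ β(y)`, from `X ⊗ Y` to the endomorphisms of `M ⊗ N`. -/
def actTensor {k : Type*} [CommRing k] {X Y M N : Type*}
    [AddCommGroup X] [Module k X] [AddCommGroup Y] [Module k Y]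
    [AddCommGroup M] [Module k M] [AddCommGroup N] [Module k N]
    (α : X →ₗ[k] M →ₗ[k] M) (β : Y →ₗ[k] N →ₗ[k] N) :
    X ⊗[k] Y →ₗ[k] (M ⊗[k] N →ₗ[k] M ⊗[k] N) :=
  TensorProduct.homTensorHomMap (RingHom.id k) M N M N ∘ₗ TensorProduct.map α β

/-- The data of a (left) `H`-module algebra: a `k`-module, an action of `H`, a multiplication
and a unit. The laws are stated in `IsModuleAlgebra`. -/
structure ModuleAlgebraData (k : Type u) [CommRing k] (H : Type u) [Ring H] [HopfAlgebra k H] where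
  /-- the underlying space -/
  carrier : Type u
  [addCommGroup : AddCommGroup carrier]
  [module : Module k carrier]
  /-- the action `x ⊗ a ↦ x ▸ a` -/
  act : H →ₗ[k] carrier →ₗ[k] carrier
  /-- the multiplication -/
  mul : carrier ⊗[k] carrier →ₗ[k] carrier
  /-- the unit -/
  one : carrier

attribute [instance] ModuleAlgebraData.addCommGroup ModuleAlgebraData.module

variable {k : Type u} [CommRing k] {H : Type u} [Ring H] [HopfAlgebra k H]

/-- The laws of a left `H`-module algebra: the multiplication is associative with unit `one`,
`act` is an action of the algebra `H`, and multiplication and unit are `H`-equivariant. -/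
structure IsModuleAlgebra (A : ModuleAlgebraData.{u} k H) : Prop where
  mul_assoc : ∀ a b c : A.carrier,
    A.mul (A.mul (a ⊗ₜ b) ⊗ₜ c) = A.mul (a ⊗ₜ A.mul (b ⊗ₜ c))
  one_mul : ∀ a : A.carrier, A.mul (A.one ⊗ₜ a) = a
  mul_one : ∀ a : A.carrier, A.mul (a ⊗ₜ A.one) = a
  act_one : ∀ a : A.carrier, A.act 1 a = a
  act_mul : ∀ (x y : H) (a : A.carrier), A.act (x * y) a = A.act x (A.act y a)
  act_mul_distrib : ∀ (x : H) (a b : A.carrier), A.act x (A.mul (a ⊗ₜ b)) =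
    A.mul (actTensor A.act A.act (Coalgebra.comul (R := k) x) (a ⊗ₜ b))
  act_unit : ∀ x : H, A.act x A.one = Coalgebra.counit (R := k) x • A.one

/-- `f` is an `H`-equivariant homomorphism of unital algebras. -/
structure IsModuleAlgebraHom (A : ModuleAlgebraData.{u} k H) (B : ModuleAlgebraData.{u} k H)
    (f : A.carrier →ₗ[k] B.carrier) : Prop where
  map_one : f A.one = B.one
  map_mul : ∀ a b : A.carrier, f (A.mul (a ⊗ₜ b)) = B.mul (f a ⊗ₜ f b)
  map_act : ∀ (x : H) (a : A.carrier), f (A.act x a) = B.act x (f a)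

/-- The base ring, with `H` acting through the counit. -/
@[reducible] def unitAlgebra (k : Type u) [CommRing k] (H : Type u) [Ring H] [HopfAlgebra k H] :
    ModuleAlgebraData.{u} k H where
  carrier := k
  act := LinearMap.lsmul k k ∘ₗ Coalgebra.counit
  mul := LinearMap.mul' k k
  one := 1

/-- The braided tensor product of two module algebras: the space `A ⊗ B` with the action
`x ▸ (a ⊗ b) = (x₍₁₎ ▸ a) ⊗ (x₍₂₎ ▸ b)` and the multiplication
`(a₁ ⊗ b₁)(a₂ ⊗ b₂) = a₁ (R₂ ▸ a₂) ⊗ (R₁ ▸ b₁) b₂`. The latter is the ordinary multiplication of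
`A ⊗ B` composed with the action of `(1 ⊗ R₁) ⊗ (R₂ ⊗ 1)` on `(A ⊗ B) ⊗ (A ⊗ B)`. -/
@[reducible] def twistedTensor (R : H ⊗[k] H) (A B : ModuleAlgebraData.{u} k H) :
    ModuleAlgebraData.{u} k H where
  carrier := A.carrier ⊗[k] B.carrier
  act := actTensor A.act B.act ∘ₗ Coalgebra.comul
  mul := TensorProduct.map A.mul B.mul ∘ₗ
    (TensorProduct.tensorTensorTensorComm k A.carrier B.carrier A.carrier B.carrier).toLinearMap ∘ₗ
    actTensor (LinearMap.lTensorHom A.carrier ∘ₗ B.act) (LinearMap.rTensorHom B.carrier ∘ₗ A.act) R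
  one := A.one ⊗ₜ B.one

/-- The twisted tensor powers of a module algebra: the base ring for `n = 0`, the algebra `A` itself
for `n = 1`, and the braided tensor product of the previous power with `A` from then on. -/
def twistedPower (R : H ⊗[k] H) (A : ModuleAlgebraData.{u} k H) : ℕ → ModuleAlgebraData.{u} k H
  | 0 => unitAlgebra k H
  | 1 => A
  | n + 2 => twistedTensor R (twistedPower R A (n + 1)) A

end ModuleAlgebras

section Dual

/-- A pairing `⟨a, x⟩` of bialgebras between `A` and `H`: the multiplication and the unit of each
factor are transposed to the comultiplication and the counit of the other one. -/
structure BialgebraPairing (k : Type u) [CommRing k] (A : Type u) [Ring A] [Bialgebra k A]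
    (H : Type u) [Ring H] [Bialgebra k H] where
  /-- the bilinear form -/
  form : A →ₗ[k] H →ₗ[k] k
  one_left : ∀ x : H, form 1 x = Coalgebra.counit (R := k) x
  mul_left : ∀ (a b : A) (x : H),
    form (a * b) x = TensorProduct.dualDistrib k H H (form a ⊗ₜ form b) (Coalgebra.comul x)
  one_right : ∀ a : A, form a 1 = Coalgebra.counit (R := k) a
  mul_right : ∀ (a : A) (x y : H),
    form a (x * y) =
      TensorProduct.dualDistrib k A A (form.flip x ⊗ₜ form.flip y) (Coalgebra.comul a)

variable {k : Type u} [CommRing k] {H : Type u} [Ring H] [HopfAlgebra k H]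
variable {A : Type u} [Ring A] [Bialgebra k A]

/-- The left coregular action `x ▹ a = a₍₁₎ ⟨a₍₂₎, x⟩`. -/
def leftCoregular (p : BialgebraPairing k A H) : H →ₗ[k] A →ₗ[k] A where
  toFun x := (TensorProduct.rid k A).toLinearMap ∘ₗ (p.form.flip x).lTensor A ∘ₗ Coalgebra.comul
  map_add' x y := by ext a; simp [LinearMap.lTensor_add]
  map_smul' c x := by ext a; simp [LinearMap.lTensor_smul]

/-- The right coregular action `a ◃ x = ⟨a₍₁₎, x⟩ a₍₂₎`. -/
def rightCoregular (p : BialgebraPairing k A H) : H →ₗ[k] A →ₗ[k] A where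
  toFun x := (TensorProduct.lid k A).toLinearMap ∘ₗ (p.form.flip x).rTensor A ∘ₗ Coalgebra.comul
  map_add' x y := by ext a; simp [LinearMap.rTensor_add]
  map_smul' c x := by ext a; simp [LinearMap.rTensor_smul]

/-- The left action `(x ⊗ y) ▸ a = y ▹ a ◃ γ(x)` of the algebra `H ⊗ H`, where `γ` is the
antipode of `H`. -/
def biAction (p : BialgebraPairing k A H) : H ⊗[k] H →ₗ[k] A →ₗ[k] A :=
  TensorProduct.lift ((LinearMap.llcomp k A A A).flip.compl₁₂
    (rightCoregular p ∘ₗ HopfAlgebra.antipode k (A := H)) (leftCoregular p))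

/-- The cocycle `R₁₃ R₂₃` in `(H ⊗ H) ⊗ (H ⊗ H)`. -/
def reCocycle (R : H ⊗[k] H) : (H ⊗[k] H) ⊗[k] (H ⊗[k] H) :=
  Algebra.TensorProduct.map (Algebra.TensorProduct.includeLeft : H →ₐ[k] H ⊗[k] H)
      (Algebra.TensorProduct.includeLeft : H →ₐ[k] H ⊗[k] H) R *
    Algebra.TensorProduct.map (Algebra.TensorProduct.includeRight : H →ₐ[k] H ⊗[k] H)
      (Algebra.TensorProduct.includeLeft : H →ₐ[k] H ⊗[k] H) R

/-- The twist of the dual `A` of `H` by the cocycle `F = R₁₃ R₂₃`: the space `A` with the same unit,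
with the multiplication `a ∘ b = (F₁ ▸ a)(F₂ ▸ b)`, and with the action of `H` obtained by
restricting the action of `H ⊗ H` along the comultiplication, so
`x ▸ a = x₍₂₎ ▹ a ◃ γ(x₍₁₎)`. -/
@[reducible] def reDual (R : H ⊗[k] H) (p : BialgebraPairing k A H) :
    ModuleAlgebraData.{u} k H where
  carrier := A
  act := biAction p ∘ₗ Coalgebra.comul
  mul := LinearMap.mul' k A ∘ₗ actTensor (biAction p) (biAction p) (reCocycle R)
  one := 1

/-- The `n`-fold coproduct of `A`, with values in the `n`-th tensor power of `A`:
`Δ⁰ = ε`, `Δ¹ = id`, `Δ² = Δ`, `Δ³ = (Δ ⊗ id) ∘ Δ` and so on. -/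
def iteratedComul (R : H ⊗[k] H) (p : BialgebraPairing k A H) :
    (n : ℕ) → A →ₗ[k] (twistedPower R (reDual R p) n).carrier
  | 0 => Coalgebra.counit (R := k) (A := A)
  | 1 => LinearMap.id (R := k) (M := A)
  | n + 2 => (TensorProduct.map (iteratedComul R p (n + 1)) (LinearMap.id (R := k) (M := A))) ∘ₗ
      Coalgebra.comul (R := k) (A := A)

end Dual

section FullDual

variable {k : Type u} [CommRing k] {H : Type u} [Ring H] [Bialgebra k H]

/-- The linear dual `H*` of `H`, as an algebra with the convolution product
`⟨ab, x⟩ = ⟨a, x₍₁₎⟩⟨b, x₍₂₎⟩` and the unit `ε`. -/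
def FullDual (k : Type u) [CommRing k] (H : Type u) [Ring H] [Bialgebra k H] : Type u :=
  WithConv (H →ₗ[k] k)

instance : Ring (FullDual k H) := inferInstanceAs (Ring (WithConv (H →ₗ[k] k)))

instance : Algebra k (FullDual k H) := inferInstanceAs (Algebra k (WithConv (H →ₗ[k] k)))

/-- An element of the dual as a linear form. -/
def evalDual : FullDual k H ≃ₗ[k] (H →ₗ[k] k) := WithConv.linearEquiv k (H →ₗ[k] k)

theorem evalDual_one (x : H) : evalDual (1 : FullDual k H) x = Coalgebra.counit (R := k) x := rfl

theorem evalDual_mul (a b : FullDual k H) (x : H) :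
    evalDual (a * b) x =
      TensorProduct.dualDistrib k H H (evalDual a ⊗ₜ evalDual b) (Coalgebra.comul x) := rfl

variable [Module.Finite k H] [Module.Projective k H]

/-- The isomorphism of `H* ⊗ M*` with `(H ⊗ M)*`. -/
def dualTensorEquiv (M : Type u) [AddCommGroup M] [Module k M] [Module.Finite k M]
    [Module.Projective k M] :
    (H →ₗ[k] k) ⊗[k] (M →ₗ[k] k) ≃ₗ[k] (H ⊗[k] M →ₗ[k] k) :=
  homTensorHomEquiv k H M k k ≪≫ₗ (TensorProduct.lid k k).congrRight

theorem dualTensorEquiv_tmul (M : Type u) [AddCommGroup M] [Module k M] [Module.Finite k M]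
    [Module.Projective k M] (a : H →ₗ[k] k) (b : M →ₗ[k] k) (x : H) (y : M) :
    dualTensorEquiv (H := H) M (a ⊗ₜ b) (x ⊗ₜ y) = a x * b y := by
  rw [dualTensorEquiv, LinearEquiv.trans_apply, homTensorHomEquiv_apply]
  rfl

/-- The isomorphism of `H* ⊗ H*` with `(H ⊗ H)*`. -/
def dualSq : FullDual k H ⊗[k] FullDual k H ≃ₗ[k] (H ⊗[k] H →ₗ[k] k) :=
  TensorProduct.congr (evalDual) (evalDual) ≪≫ₗ
    dualTensorEquiv (H := H) H

/-- The isomorphism of `H* ⊗ H* ⊗ H*` with `(H ⊗ H ⊗ H)*`. -/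
def dualCube : FullDual k H ⊗[k] (FullDual k H ⊗[k] FullDual k H) ≃ₗ[k]
    (H ⊗[k] (H ⊗[k] H) →ₗ[k] k) :=
  TensorProduct.congr (evalDual) dualSq ≪≫ₗ dualTensorEquiv (H := H) (H ⊗[k] H)

theorem dualSq_tmul (a b : FullDual k H) (x y : H) :
    dualSq (a ⊗ₜ b) (x ⊗ₜ y) = evalDual a x * evalDual b y := by
  simp [dualSq, dualTensorEquiv_tmul]

theorem dualCube_tmul (a : FullDual k H) (t : FullDual k H ⊗[k] FullDual k H) (x : H)
    (y : H ⊗[k] H) : dualCube (a ⊗ₜ t) (x ⊗ₜ y) = evalDual a x * dualSq t y := by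
  simp [dualCube, dualTensorEquiv_tmul]

/-- The comultiplication of the dual is the transpose of the multiplication of `H`, the counit is
the evaluation at `1`. -/
instance : CoalgebraStruct k (FullDual k H) where
  comul := dualSq.symm.toLinearMap ∘ₗ (LinearMap.lcomp k k (LinearMap.mul' k H)) ∘ₗ
    evalDual.toLinearMap
  counit := LinearMap.applyₗ (1 : H) ∘ₗ evalDual.toLinearMap

theorem dualSq_comul (a : FullDual k H) (x y : H) :
    dualSq (Coalgebra.comul (R := k) a) (x ⊗ₜ y) = evalDual a (x * y) := by
  simp [CoalgebraStruct.comul]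

theorem dual_counit (a : FullDual k H) : Coalgebra.counit (R := k) a = evalDual a 1 := rfl

theorem dualCube_lTensor (t : FullDual k H ⊗[k] FullDual k H) (x y z : H) :
    dualCube ((Coalgebra.comul (R := k) (A := FullDual k H)).lTensor _ t) (x ⊗ₜ (y ⊗ₜ z)) =
      dualSq t (x ⊗ₜ (y * z)) := by
  induction t with
  | zero => simp
  | add s t hs ht => simp only [map_add, LinearMap.add_apply, hs, ht]
  | tmul a b => simp [dualCube_tmul, dualSq_comul, dualSq_tmul]

theorem dualCube_assoc (t : FullDual k H ⊗[k] FullDual k H) (b : FullDual k H) (x y z : H) :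
    dualCube (TensorProduct.assoc k _ _ _ (t ⊗ₜ b)) (x ⊗ₜ (y ⊗ₜ z)) =
      dualSq t (x ⊗ₜ y) * evalDual b z := by
  induction t with
  | zero => simp
  | add s t hs ht =>
    simp only [TensorProduct.add_tmul, map_add, LinearMap.add_apply, hs, ht, add_mul]
  | tmul a c => simp [dualCube_tmul, dualSq_tmul, mul_assoc]

theorem dualCube_rTensor (t : FullDual k H ⊗[k] FullDual k H) (x y z : H) :
    dualCube (TensorProduct.assoc k _ _ _
      ((Coalgebra.comul (R := k) (A := FullDual k H)).rTensor _ t)) (x ⊗ₜ (y ⊗ₜ z)) =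
      dualSq t ((x * y) ⊗ₜ z) := by
  induction t with
  | zero => simp
  | add s t hs ht => simp only [map_add, LinearMap.add_apply, hs, ht]
  | tmul a b =>
    rw [LinearMap.rTensor_tmul, dualCube_assoc, dualSq_comul, dualSq_tmul]

theorem dualSq_rTensor_counit (t : FullDual k H ⊗[k] FullDual k H) (y : H) :
    evalDual (TensorProduct.lid k _ ((Coalgebra.counit (R := k) (A := FullDual k H)).rTensor _ t)) y =
      dualSq t (1 ⊗ₜ y) := by
  induction t with
  | zero => simp
  | add s t hs ht => simp only [map_add, LinearMap.add_apply, hs, ht]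
  | tmul a b => simp [dualSq_tmul, dual_counit]

theorem dualSq_lTensor_counit (t : FullDual k H ⊗[k] FullDual k H) (x : H) :
    evalDual (TensorProduct.rid k _ ((Coalgebra.counit (R := k) (A := FullDual k H)).lTensor _ t)) x =
      dualSq t (x ⊗ₜ 1) := by
  induction t with
  | zero => simp
  | add s t hs ht => simp only [map_add, LinearMap.add_apply, hs, ht]
  | tmul a b => simp [dualSq_tmul, dual_counit, mul_comm]

instance : Coalgebra k (FullDual k H) where
  coassoc := by
    ext1 a
    apply dualCube.injective
    ext x y z
    simp only [LinearMap.comp_apply, LinearEquiv.coe_coe, TensorProduct.AlgebraTensorModule.curry_apply,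
      TensorProduct.curry_apply, LinearMap.restrictScalars_self]
    rw [dualCube_rTensor, dualCube_lTensor, dualSq_comul, dualSq_comul, mul_assoc]
  rTensor_counit_comp_comul := by
    ext1 a
    apply (TensorProduct.lid k (FullDual k H)).injective
    apply evalDual.injective
    ext y
    simp only [LinearMap.comp_apply]
    rw [dualSq_rTensor_counit, dualSq_comul]
    simp
  lTensor_counit_comp_comul := by
    ext1 a
    apply (TensorProduct.rid k (FullDual k H)).injective
    apply evalDual.injective
    ext y
    simp only [LinearMap.comp_apply]
    rw [dualSq_lTensor_counit, dualSq_comul]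
    simp

theorem dualSq_mul (s t : FullDual k H ⊗[k] FullDual k H) (x y : H) :
    dualSq (s * t) (x ⊗ₜ y) =
      TensorProduct.dualDistrib k (H ⊗[k] H) (H ⊗[k] H) (dualSq s ⊗ₜ dualSq t)
        (TensorProduct.tensorTensorTensorComm k H H H H
          (Coalgebra.comul (R := k) x ⊗ₜ Coalgebra.comul (R := k) y)) := by
  induction s with
  | zero => simp
  | add s s' hs hs' =>
    simp only [add_mul, map_add, LinearMap.add_apply, hs, hs', TensorProduct.add_tmul]
  | tmul a b =>
    induction t with
    | zero => simp
    | add t t' ht ht' =>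
      simp only [mul_add, map_add, LinearMap.add_apply, ht, ht', TensorProduct.tmul_add]
    | tmul c d =>
      rw [Algebra.TensorProduct.tmul_mul_tmul, dualSq_tmul, evalDual_mul, evalDual_mul]
      generalize (Coalgebra.comul (R := k) x) = u
      generalize (Coalgebra.comul (R := k) y) = v
      induction u with
      | zero => simp
      | add u u' hu hu' => simp only [map_add, TensorProduct.add_tmul, add_mul, hu, hu']
      | tmul p q =>
        induction v with
        | zero => simp
        | add v v' hv hv' => simp only [map_add, TensorProduct.tmul_add, mul_add, hv, hv']
        | tmul r s =>
          simp only [TensorProduct.dualDistrib_apply, TensorProduct.tensorTensorTensorComm_tmul,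
            dualSq_tmul]
          ring

theorem dualDistrib_dualSq (a b : FullDual k H) (u v : H ⊗[k] H) :
    TensorProduct.dualDistrib k (H ⊗[k] H) (H ⊗[k] H)
        (dualSq (Coalgebra.comul (R := k) a) ⊗ₜ dualSq (Coalgebra.comul (R := k) b))
        (TensorProduct.tensorTensorTensorComm k H H H H (u ⊗ₜ v)) =
      TensorProduct.dualDistrib k H H (evalDual a ⊗ₜ evalDual b) (u * v) := by
  induction u with
  | zero => simp
  | add u u' hu hu' => simp only [map_add, TensorProduct.add_tmul, add_mul, hu, hu']
  | tmul p q =>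
    induction v with
    | zero => simp
    | add v v' hv hv' => simp only [map_add, TensorProduct.tmul_add, mul_add, hv, hv']
    | tmul r s => simp [dualSq_comul]

instance : Bialgebra k (FullDual k H) :=
  Bialgebra.mk' k (FullDual k H)
    (by rw [dual_counit, evalDual_one, Bialgebra.counit_one])
    (fun {a b} => by
      simp [dual_counit, evalDual_mul, Algebra.TensorProduct.one_def])
    (by
      apply dualSq.injective
      ext x y
      simp [dualSq_comul, Algebra.TensorProduct.one_def, dualSq_tmul, evalDual_one])
    (fun {a b} => by
      apply dualSq.injective
      ext x y
      simp only [TensorProduct.AlgebraTensorModule.curry_apply, TensorProduct.curry_apply,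
        LinearMap.restrictScalars_self]
      rw [dualSq_comul, dualSq_mul, dualDistrib_dualSq, evalDual_mul, Bialgebra.comul_mul])

/-- The canonical pairing `⟨a, x⟩ = a(x)` between the dual of `H` and `H`. -/
def canonicalPairing (k : Type u) [CommRing k] (H : Type u) [Ring H] [Bialgebra k H]
    [Module.Finite k H] [Module.Projective k H] : BialgebraPairing k (FullDual k H) H where
  form := evalDual.toLinearMap
  one_left := evalDual_one
  mul_left := evalDual_mul
  one_right _ := rfl
  mul_right a x y := by
    rw [LinearEquiv.coe_coe, ← dualSq_comul]
    generalize (Coalgebra.comul (R := k) a) = t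
    induction t with
    | zero => simp
    | add s t hs ht => simp only [map_add, LinearMap.add_apply, hs, ht]
    | tmul b c => simp [dualSq_tmul]

end FullDual

end REDual
end

/-! Write `x ▸ a` for the coadjoint action `x₍₂₎ ▹ a ◃ γ(x₍₁₎)`. Since `(Δ ⊗ id)(R) = R₁₃ R₂₃`, the
cocycle is `(Δ ⊗ id)(R)` with `1` put into the last slot, so `a ∘ b = (R₁ ▸ a)(b ◃ γ(R₂))`
(`reMul_tmul`). Everything else is computed from this formula.

The antipode reverses coproducts, so `H` does not act on the ordinary product of `A` by module
algebra rules: the first and third legs of `x` fall on `b` and the middle one on `a`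
(`coadjoint_apply_mul`). The relation `R Δ = Δᵒᵖ R` repairs the order for `∘` (`coadjoint_reMul`),
and the two formulas for the coproducts of `R` then give associativity (`reMul_assoc`). The same
relations make braided tensor products of module algebras into module algebras.

For the coproduct, expand `Δ(a) Δ(b)` in the braided square. An element acting by `▹` on one leg of
`Δ(a)` may be moved to the next leg as `◃`, where it meets an antipode. The resulting factors
cancel, by `h₁ γ(h₂) = ε(h)` for equivariance (`comul_coadjoint`), and by the two inversion formulas
`sw_R_antipode_fst` and `sw_R_antipode_snd` for multiplicativity (`comul_reMul`). What survives is
`Δ(a ∘ b)`.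

Higher coproducts follow by induction, because the braided product is functorial for equivariant
algebra maps. Only the pairing enters the argument, so the full dual is a special case. -/

noncomputable section

namespace REDual

/-! ### Sums over representations of tensors, and multilinear functions of the legs. -/

section Sweedler

variable {k : Type*} [CommRing k]
variable {M N P Q : Type*} [AddCommGroup M] [Module k M] [AddCommGroup N] [Module k N]
  [AddCommGroup P] [Module k P] [AddCommGroup Q] [Module k Q]

/-- Sweedler notation: `∑ f(t₁, t₂)`, for a chosen representation `t = ∑ t₁ ⊗ t₂`. -/
def sw {P : Type*} [AddCommMonoid P] (t : M ⊗[k] N) (f : M → N → P) : P :=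
  ∑ p ∈ (TensorProduct.exists_finset t).choose, f p.1 p.2

theorem sw_tmul (t : M ⊗[k] N) : sw t (fun x y => x ⊗ₜ[k] y) = t :=
  (TensorProduct.exists_finset t).choose_spec.symm

theorem sw_congr {P : Type*} [AddCommMonoid P] (t : M ⊗[k] N) {f g : M → N → P}
    (h : ∀ x y, f x y = g x y) : sw t f = sw t g :=
  Finset.sum_congr rfl fun _ _ => h _ _

theorem map_sw {F P Q : Type*} [AddCommMonoid P] [AddCommMonoid Q] [FunLike F P Q]
    [AddMonoidHomClass F P Q] (φ : F) (t : M ⊗[k] N) (f : M → N → P) :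
    φ (sw t f) = sw t fun x y => φ (f x y) :=
  map_sum φ _ _

theorem apply_eq_sw {P F : Type*} [AddCommMonoid P] [FunLike F (M ⊗[k] N) P]
    [AddMonoidHomClass F (M ⊗[k] N) P] (φ : F) (t : M ⊗[k] N) :
    φ t = sw t fun x y => φ (x ⊗ₜ y) := by
  conv_lhs => rw [← sw_tmul t, map_sw]

theorem sw_swap {M' N' P : Type*} [AddCommGroup M'] [Module k M'] [AddCommGroup N'] [Module k N']
    [AddCommMonoid P] (t : M ⊗[k] N) (s : M' ⊗[k] N') (f : M → N → M' → N' → P) :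
    (sw t fun x y => sw s fun z w => f x y z w) = sw s fun z w => sw t fun x y => f x y z w :=
  Finset.sum_comm

theorem sw_add {P : Type*} [AddCommMonoid P] (t : M ⊗[k] N) (f g : M → N → P) :
    (sw t fun x y => f x y + g x y) = sw t f + sw t g :=
  Finset.sum_add_distrib

theorem smul_sw (c : k) (t : M ⊗[k] N) (f : M → N → P) :
    c • sw t f = sw t fun x y => c • f x y :=
  Finset.smul_sum

theorem sw_smul (t : M ⊗[k] N) (f : M → N → k) (b : P) :
    sw t f • b = sw t fun x y => f x y • b :=
  Finset.sum_smul

theorem sw_mul {B : Type*} [Ring B] (t : M ⊗[k] N) (f : M → N → B) (b : B) :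
    sw t f * b = sw t fun x y => f x y * b :=
  Finset.sum_mul _ _ _

theorem mul_sw {B : Type*} [Ring B] (t : M ⊗[k] N) (f : M → N → B) (b : B) :
    b * sw t f = sw t fun x y => b * f x y :=
  Finset.mul_sum _ _ _

theorem sw_tmul_right (t : M ⊗[k] N) (f : M → N → P) (b : Q) :
    sw t f ⊗ₜ[k] b = sw t fun x y => f x y ⊗ₜ[k] b :=
  TensorProduct.sum_tmul _ _ _

theorem tmul_sw (t : M ⊗[k] N) (f : M → N → P) (b : Q) :
    b ⊗ₜ[k] sw t f = sw t fun x y => b ⊗ₜ[k] f x y :=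
  TensorProduct.tmul_sum _ _ _

theorem sw_apply (t : M ⊗[k] N) (f : M → N → P →ₗ[k] Q) (a : P) :
    sw t f a = sw t fun x y => f x y a :=
  LinearMap.sum_apply _ _ _

variable (k) in
/-- The function `f` of two variables is `k`-bilinear. -/
structure IsBilin (f : M → N → P) : Prop where
  -- The laws carry default proofs, so that `{}` certifies multilinearity of most concrete
  -- expressions.
  add_left : ∀ x x' y, f (x + x') y = f x y + f x' y := by
    intros; simp [add_mul, mul_add, TensorProduct.add_tmul, TensorProduct.tmul_add, sw_add, add_smul,
      smul_add]
  smul_left : ∀ (c : k) x y, f (c • x) y = c • f x y := by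
    intros; simp [← TensorProduct.smul_tmul', smul_sw, smul_smul, mul_comm, mul_left_comm]
  add_right : ∀ x y y', f x (y + y') = f x y + f x y' := by
    intros; simp [add_mul, mul_add, TensorProduct.add_tmul, TensorProduct.tmul_add, sw_add, add_smul,
      smul_add]
  smul_right : ∀ (c : k) x y, f x (c • y) = c • f x y := by
    intros; simp [← TensorProduct.smul_tmul', smul_sw, smul_smul, mul_comm, mul_left_comm]

/-- The linear map on the tensor product that belongs to a bilinear function. -/
def IsBilin.toLin {f : M → N → P} (hf : IsBilin k f) : M ⊗[k] N →ₗ[k] P :=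
  TensorProduct.lift (LinearMap.mk₂ k f hf.add_left hf.smul_left hf.add_right hf.smul_right)

theorem IsBilin.toLin_tmul {f : M → N → P} (hf : IsBilin k f) (x : M) (y : N) :
    hf.toLin (x ⊗ₜ y) = f x y := rfl

/-- Bilinearity makes the sum independent of the chosen representation; this is what allows a tensor
identity to be applied under `sw`. -/
theorem IsBilin.toLin_apply {f : M → N → P} (hf : IsBilin k f) (t : M ⊗[k] N) :
    hf.toLin t = sw t f := by
  rw [apply_eq_sw]; rfl

theorem sw_pure {f : M → N → P} (hf : IsBilin k f) (x : M) (y : N) :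
    sw (x ⊗ₜ[k] y) f = f x y := by
  rw [← hf.toLin_apply, hf.toLin_tmul]

theorem IsBilin.map_sw_left {M' N' : Type*} [AddCommGroup M'] [Module k M'] [AddCommGroup N']
    [Module k N'] {f : M → N → P} (hf : IsBilin k f) (t : M' ⊗[k] N') (g : M' → N' → M) (b : N) :
    f (sw t g) b = sw t fun x y => f (g x y) b := by
  simp only [← hf.toLin_tmul, sw_tmul_right, map_sw]

theorem IsBilin.map_sw_right {M' N' : Type*} [AddCommGroup M'] [Module k M'] [AddCommGroup N']
    [Module k N'] {f : M → N → P} (hf : IsBilin k f) (t : M' ⊗[k] N') (g : M' → N' → N) (a : M) :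
    f a (sw t g) = sw t fun x y => f a (g x y) := by
  simp only [← hf.toLin_tmul, tmul_sw, map_sw]

theorem sw_sw {M' N' : Type*} [AddCommGroup M'] [Module k M'] [AddCommGroup N'] [Module k N']
    {f : M → N → P} (hf : IsBilin k f) (t : M' ⊗[k] N') (g : M' → N' → M ⊗[k] N) :
    sw (sw t g) f = sw t fun x y => sw (g x y) f := by
  simp only [← hf.toLin_apply, map_sw]

variable (k) in
/-- The function `f` of three variables is `k`-trilinear. -/
structure IsTrilin {L : Type*} [AddCommGroup L] [Module k L] (f : L → M → N → P) : Prop where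
  add₁ : ∀ x x' y z, f (x + x') y z = f x y z + f x' y z := by
    intros; simp [add_mul, mul_add, TensorProduct.add_tmul, TensorProduct.tmul_add, sw_add, add_smul,
      smul_add]
  smul₁ : ∀ (c : k) x y z, f (c • x) y z = c • f x y z := by
    intros; simp [← TensorProduct.smul_tmul', smul_sw, smul_smul, mul_comm, mul_left_comm]
  add₂ : ∀ x y y' z, f x (y + y') z = f x y z + f x y' z := by
    intros; simp [add_mul, mul_add, TensorProduct.add_tmul, TensorProduct.tmul_add, sw_add, add_smul,
      smul_add]
  smul₂ : ∀ (c : k) x y z, f x (c • y) z = c • f x y z := by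
    intros; simp [← TensorProduct.smul_tmul', smul_sw, smul_smul, mul_comm, mul_left_comm]
  add₃ : ∀ x y z z', f x y (z + z') = f x y z + f x y z' := by
    intros; simp [add_mul, mul_add, TensorProduct.add_tmul, TensorProduct.tmul_add, sw_add, add_smul,
      smul_add]
  smul₃ : ∀ (c : k) x y z, f x y (c • z) = c • f x y z := by
    intros; simp [← TensorProduct.smul_tmul', smul_sw, smul_smul, mul_comm, mul_left_comm]

namespace IsTrilin

variable {L : Type*} [AddCommGroup L] [Module k L] {f : L → M → N → P}

theorem right (hf : IsTrilin k f) (x : L) : IsBilin k (f x) :=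
  ⟨hf.add₂ x, fun c => hf.smul₂ c x, hf.add₃ x, fun c => hf.smul₃ c x⟩

theorem outer (hf : IsTrilin k f) : IsBilin k (fun x (t : M ⊗[k] N) => sw t (f x)) where
  add_left x x' t := (sw_congr t fun y z => hf.add₁ x x' y z).trans (sw_add t _ _)
  smul_left c x t := (sw_congr t fun y z => hf.smul₁ c x y z).trans (smul_sw c t _).symm
  add_right x t t' := by simp only [← (hf.right x).toLin_apply, map_add]
  smul_right c x t := by simp only [← (hf.right x).toLin_apply, map_smul]

/-- The linear map on `L ⊗ (M ⊗ N)` that belongs to a trilinear function. -/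
def toLin (hf : IsTrilin k f) : L ⊗[k] (M ⊗[k] N) →ₗ[k] P := hf.outer.toLin

theorem toLin_tmul (hf : IsTrilin k f) (x : L) (y : M) (z : N) :
    hf.toLin (x ⊗ₜ (y ⊗ₜ z)) = f x y z := by
  rw [toLin, hf.outer.toLin_tmul, sw_pure (hf.right x)]

end IsTrilin

end Sweedler

/-! ### Coalgebra, Hopf algebra and R-matrix identities in Sweedler form. -/

section Sweedler

open Coalgebra

variable {k : Type*} [CommRing k] {P : Type*} [AddCommGroup P] [Module k P]

section Coalgebra

variable {C : Type*} [AddCommGroup C] [Module k C] [Coalgebra k C]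

theorem sw_comul_counit_left {f : C → P} (hf : IsLinearMap k f) (x : C) :
    (sw (comul (R := k) x) fun y z => counit (R := k) y • f z) = f x := by
  have h := congrArg ((hf.mk' f) ∘ₗ (TensorProduct.lid k C).toLinearMap)
    (rTensor_counit_comul (R := k) x)
  rw [← LinearMap.comp_apply, apply_eq_sw] at h
  simpa using h

theorem sw_comul_counit_right {f : C → P} (hf : IsLinearMap k f) (x : C) :
    (sw (comul (R := k) x) fun y z => counit (R := k) z • f y) = f x := by
  have h := congrArg ((hf.mk' f) ∘ₗ (TensorProduct.rid k C).toLinearMap)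
    (lTensor_counit_comul (R := k) x)
  rw [← LinearMap.comp_apply, apply_eq_sw] at h
  simpa using h

theorem sw_coassoc {f : C → C → C → P} (hf : IsTrilin k f) (x : C) :
    (sw (comul (R := k) x) fun y z => sw (comul (R := k) y) fun u v => f u v z) =
      sw (comul (R := k) x) fun y z => sw (comul (R := k) z) fun u v => f y u v := by
  have h := congrArg hf.toLin (coassoc_apply (R := k) x)
  rw [apply_eq_sw (LinearMap.lTensor C comul) (comul x), ← sw_tmul (k := k) (comul (R := k) x)] at h
  simp only [map_sw, LinearMap.rTensor_tmul, LinearMap.lTensor_tmul] at h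
  rw [sw_tmul] at h
  refine Eq.trans (sw_congr _ fun y z => ?_) (h.trans (sw_congr _ fun y z => ?_))
  · conv_rhs => rw [← sw_tmul (k := k) (comul (R := k) y)]
    simp only [sw_tmul_right, map_sw, TensorProduct.assoc_tmul, hf.toLin_tmul]
  · conv_lhs => rw [← sw_tmul (k := k) (comul (R := k) z)]
    simp only [tmul_sw, map_sw, hf.toLin_tmul]

end Coalgebra

section Bialgebra

variable {B : Type*} [Ring B] [Bialgebra k B]

theorem sw_comul_one {f : B → B → P} (hf : IsBilin k f) :
    sw (comul (R := k) (1 : B)) f = f 1 1 := by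
  rw [Bialgebra.comul_one, Algebra.TensorProduct.one_def, sw_pure hf]

theorem sw_mul_tensor {B' : Type*} [Ring B'] [Algebra k B'] {f : B → B' → P} (hf : IsBilin k f)
    (s t : B ⊗[k] B') :
    sw (s * t) f = sw s fun x y => sw t fun z w => f (x * z) (y * w) := by
  conv_lhs => rw [← sw_tmul s, ← sw_tmul t]
  simp only [sw_mul, mul_sw, sw_sw hf, Algebra.TensorProduct.tmul_mul_tmul, sw_pure hf]
  rw [sw_swap]

theorem sw_comul_mul {f : B → B → P} (hf : IsBilin k f) (x y : B) :
    sw (comul (R := k) (x * y)) f = sw (comul (R := k) x) fun x₁ x₂ =>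
      sw (comul (R := k) y) fun y₁ y₂ => f (x₁ * y₁) (x₂ * y₂) := by
  rw [Bialgebra.comul_mul, sw_mul_tensor hf]

end Bialgebra

section HopfAlgebra

variable {H : Type*} [Ring H] [HopfAlgebra k H]

open HopfAlgebra

theorem sw_antipode_mul {f : H → P} (hf : IsLinearMap k f) (x : H) :
    (sw (comul (R := k) x) fun y z => f (antipode k y * z)) = counit (R := k) x • f 1 := by
  have h := congrArg (hf.mk' f) (mul_antipode_rTensor_comul_apply (R := k) x)
  rw [← sw_tmul (k := k) (comul (R := k) x)] at h
  simpa [map_sw, Algebra.algebraMap_eq_smul_one, hf.map_smul] using h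

theorem sw_mul_antipode {f : H → P} (hf : IsLinearMap k f) (x : H) :
    (sw (comul (R := k) x) fun y z => f (y * antipode k z)) = counit (R := k) x • f 1 := by
  have h := congrArg (hf.mk' f) (mul_antipode_lTensor_comul_apply (R := k) x)
  rw [← sw_tmul (k := k) (comul (R := k) x)] at h
  simpa [map_sw, Algebra.algebraMap_eq_smul_one, hf.map_smul] using h

-- In the convolution algebra of maps `H → H ⊗ H`, the flipped `γ ⊗ γ` after `Δ` is a left inverse
-- of `Δ`, while `Δ ∘ γ` is a right inverse. Hence they agree.
open WithConv in
theorem comul_antipode (x : H) : comul (R := k) (antipode k x) =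
    sw (comul (R := k) x) fun y z => antipode k z ⊗ₜ[k] antipode k y := by
  let G : H →ₗ[k] H ⊗[k] H :=
    TensorProduct.map (antipode k) (antipode k) ∘ₗ (TensorProduct.comm k H H).toLinearMap ∘ₗ comul
  have hG : toConv G * toConv (comul (R := k) (A := H)) = 1 := by
    have hGy (y : H) : G y = sw (comul (R := k) y) fun u v => antipode k v ⊗ₜ antipode k u := by
      simp only [G, LinearMap.comp_apply]
      conv_lhs => rw [← sw_tmul (k := k) (comul (R := k) y)]
      simp [map_sw]
    apply WithConv.ext
    ext x
    have h₁ : (toConv G * toConv (comul (R := k) (A := H))).ofConv x =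
        sw (comul (R := k) x) fun y z => G y * comul (R := k) z := by
      rw [LinearMap.convMul_apply, apply_eq_sw (TensorProduct.map _ _) (comul x), map_sw]
      rfl
    -- The innermost antipode contracts in the first leg, by coassociativity, and leaves `γ(u) z` in
    -- the second leg for another contraction.
    have h₂ (u z : H) : (sw (comul (R := k) z) fun v w =>
        (antipode k v ⊗ₜ antipode k u) * comul (R := k) w) = 1 ⊗ₜ[k] (antipode k u * z) := by
      have h (v w : H) : (antipode k v ⊗ₜ antipode k u) * comul (R := k) w =
          sw (comul (R := k) w) fun p q => (antipode k v * p) ⊗ₜ[k] (antipode k u * q) := by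
        conv_lhs => rw [← sw_tmul (k := k) (comul (R := k) w)]
        simp only [mul_sw, Algebra.TensorProduct.tmul_mul_tmul]
      simp only [h]
      rw [← sw_coassoc (f := fun v p q => (antipode k v * p) ⊗ₜ[k] (antipode k u * q)) {}]
      have h' (y q : H) : (sw (comul (R := k) y) fun v p =>
          (antipode k v * p) ⊗ₜ[k] (antipode k u * q)) = counit (R := k) y •
            1 ⊗ₜ[k] (antipode k u * q) :=
        sw_antipode_mul (f := fun v => v ⊗ₜ[k] (antipode k u * q))
          ⟨by simp [TensorProduct.add_tmul], by simp [TensorProduct.smul_tmul']⟩ y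
      simp only [h']
      exact sw_comul_counit_left (f := fun q => 1 ⊗ₜ[k] (antipode k u * q))
        ⟨by simp [mul_add, TensorProduct.tmul_add], by simp⟩ z
    rw [h₁]
    simp only [hGy, sw_mul]
    rw [sw_coassoc (f := fun u v w => (antipode k v ⊗ₜ antipode k u) * comul (R := k) w) {}]
    simp only [h₂]
    rw [sw_antipode_mul (f := fun q => (1 : H) ⊗ₜ[k] q) ⟨by simp [TensorProduct.tmul_add], by simp⟩]
    simp [Algebra.TensorProduct.one_def, Algebra.algebraMap_eq_smul_one]
  have := left_inv_eq_right_inv hG LinearMap.comul_right_inv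
  have h2 := congrArg (fun φ => φ.ofConv x) this
  simp only [LinearMap.comp_apply] at h2
  rw [← h2]
  simp only [G, LinearMap.comp_apply]
  conv_lhs => rw [← sw_tmul (k := k) (comul (R := k) x)]
  simp [map_sw]

theorem sw_comul_antipode {f : H → H → P} (hf : IsBilin k f) (x : H) :
    sw (comul (R := k) (antipode k x)) f =
      sw (comul (R := k) x) fun y z => f (antipode k z) (antipode k y) := by
  simp only [comul_antipode, sw_sw hf, sw_pure hf]

end HopfAlgebra

/-! ### Consequences of the axioms of a universal R-matrix. -/

section RMatrix

variable {k : Type u} [CommRing k] {P : Type*} [AddCommGroup P] [Module k P]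
variable {H : Type u} [Ring H] [HopfAlgebra k H] {R : H ⊗[k] H}

open HopfAlgebra

theorem sw_comul_fst_R (hR : IsUniversalRMatrix R) {f : H → H → H → P} (hf : IsTrilin k f) :
    (sw R fun x y => sw (comul (R := k) x) fun u v => f u v y) =
      sw R fun x y => sw R fun z w => f x z (y * w) := by
  have h := congrArg hf.toLin hR.comul_left
  rw [apply_eq_sw (LinearMap.rTensor H comul) R] at h
  conv_rhs at h => rw [apply_eq_sw leg13 R, apply_eq_sw leg23 R]
  simp only [map_sw, LinearMap.rTensor_tmul, sw_mul, mul_sw, leg13, leg23,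
    Algebra.TensorProduct.map_tmul, Algebra.TensorProduct.includeRight_apply, AlgHom.coe_id, id,
    Algebra.TensorProduct.tmul_mul_tmul, one_mul, mul_one, hf.toLin_tmul] at h
  rw [sw_swap] at h
  refine Eq.trans (sw_congr _ fun y z => ?_) h
  conv_rhs => rw [← sw_tmul (k := k) (comul (R := k) y)]
  simp only [sw_tmul_right, map_sw, TensorProduct.assoc_tmul, hf.toLin_tmul]

theorem sw_comul_snd_R (hR : IsUniversalRMatrix R) {f : H → H → H → P} (hf : IsTrilin k f) :
    (sw R fun x y => sw (comul (R := k) y) fun u v => f x u v) =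
      sw R fun x y => sw R fun z w => f (x * z) w y := by
  have h := congrArg hf.toLin hR.comul_right
  rw [apply_eq_sw (LinearMap.lTensor H comul) R] at h
  conv_rhs at h => rw [apply_eq_sw leg13 R, apply_eq_sw leg12 R]
  simp only [map_sw, LinearMap.lTensor_tmul, sw_mul, mul_sw, leg13, leg12,
    Algebra.TensorProduct.map_tmul, Algebra.TensorProduct.includeRight_apply,
    Algebra.TensorProduct.includeLeft_apply, AlgHom.coe_id, id,
    Algebra.TensorProduct.tmul_mul_tmul, one_mul, mul_one, hf.toLin_tmul] at h
  rw [sw_swap] at h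
  refine Eq.trans (sw_congr _ fun y z => ?_) h
  conv_rhs => rw [← sw_tmul (k := k) (comul (R := k) z)]
  simp only [tmul_sw, map_sw, hf.toLin_tmul]

theorem sw_R_comul (hR : IsUniversalRMatrix R) {f : H → H → P} (hf : IsBilin k f) (h : H) :
    (sw R fun x y => sw (comul (R := k) h) fun u v => f (x * u) (y * v)) =
      sw (comul (R := k) h) fun u v => sw R fun x y => f (v * x) (u * y) := by
  have e := congrArg hf.toLin (hR.comul_op h)
  rw [hf.toLin_apply, hf.toLin_apply, sw_mul_tensor hf, sw_mul_tensor hf] at e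
  refine e.trans ?_
  have hc : TensorProduct.comm k H H (comul (R := k) h) =
      sw (comul (R := k) h) fun u v => v ⊗ₜ[k] u := by
    conv_lhs => rw [← sw_tmul (k := k) (comul (R := k) h)]
    simp only [map_sw, TensorProduct.comm_tmul]
  have hb : IsBilin k fun x y => sw R fun z w => f (x * z) (y * w) := by
    constructor <;>
    simp [add_mul, hf.add_left, hf.add_right, hf.smul_left, hf.smul_right, sw_add, smul_sw]
  rw [hc, sw_sw hb]
  exact sw_congr _ fun u v => sw_pure hb v u

/-- Applying `ε` to the first leg of `(Δ ⊗ id)(R) = R₁₃ R₂₃` gives `R = (1 ⊗ e) R` with `e = (ε ⊗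
id)(R)`. Cancelling the invertible `R` leaves `e = 1`. -/
theorem sw_counit_fst_R (hR : IsUniversalRMatrix R) {f : H → P} (hf : IsLinearMap k f) :
    (sw R fun x y => counit (R := k) x • f y) = f 1 := by
  have h := sw_comul_fst_R hR (f := fun u v y => counit (R := k) u • v ⊗ₜ[k] y) {}
  have h₀ (x y : H) := sw_comul_counit_left (k := k) (f := fun v => v ⊗ₜ[k] y)
    ⟨by simp [TensorProduct.add_tmul], by simp [TensorProduct.smul_tmul']⟩ x
  simp only [h₀, sw_tmul] at h
  have h' : R = (1 ⊗ₜ[k] sw R fun x y => counit (R := k) x • y) * R := by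
    have hm (e : H) : (1 ⊗ₜ[k] e) * R = sw R fun z w => z ⊗ₜ[k] (e * w) := by
      conv_lhs => rw [← sw_tmul (k := k) R]
      simp only [mul_sw, Algebra.TensorProduct.tmul_mul_tmul, one_mul]
    refine h.trans ?_
    simp only [hm, sw_mul, smul_sw, tmul_sw, smul_mul_assoc, TensorProduct.tmul_smul]
  have h₁ := (hR.isUnit.mul_eq_right).1 h'.symm
  have h₂ := congrArg ((hf.mk' f) ∘ₗ (TensorProduct.lid k H).toLinearMap ∘ₗ
    (counit (R := k) (A := H)).rTensor H) h₁
  simpa [Algebra.TensorProduct.one_def, map_sw, hf.map_smul] using h₂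

theorem sw_counit_snd_R (hR : IsUniversalRMatrix R) {f : H → P} (hf : IsLinearMap k f) :
    (sw R fun x y => counit (R := k) y • f x) = f 1 := by
  have h := sw_comul_snd_R hR (f := fun x u v => counit (R := k) v • x ⊗ₜ[k] u) {}
  have h₀ (x y : H) := sw_comul_counit_right (k := k) (f := fun v => x ⊗ₜ[k] v)
    ⟨by simp [TensorProduct.tmul_add], by simp⟩ y
  simp only [h₀, sw_tmul] at h
  have h' : R = ((sw R fun x y => counit (R := k) y • x) ⊗ₜ[k] 1) * R := by
    have hm (e : H) : (e ⊗ₜ[k] 1) * R = sw R fun z w => (e * z) ⊗ₜ[k] w := by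
      conv_lhs => rw [← sw_tmul (k := k) R]
      simp only [mul_sw, Algebra.TensorProduct.tmul_mul_tmul, one_mul]
    refine h.trans ?_
    simp only [hm, sw_mul, smul_sw, sw_tmul_right, smul_mul_assoc, ← TensorProduct.smul_tmul']
  have h₁ := (hR.isUnit.mul_eq_right).1 h'.symm
  have h₂ := congrArg ((hf.mk' f) ∘ₗ (TensorProduct.rid k H).toLinearMap ∘ₗ
    (counit (R := k) (A := H)).lTensor H) h₁
  simpa [Algebra.TensorProduct.one_def, map_sw, hf.map_smul] using h₂

/-- Contract the last two legs of `(id ⊗ Δ)(R) = R₁₃ R₁₂` with `u γ(v)`. The second legs multiply in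
reversed order, so this is an inversion formula in `H ⊗ Hᵒᵖ`. -/
theorem sw_R_antipode_snd (hR : IsUniversalRMatrix R) {f : H → H → P} (hf : IsBilin k f) :
    (sw R fun x y => sw R fun z w => f (x * z) (w * antipode k y)) = f 1 1 := by
  rw [← sw_comul_snd_R hR (f := fun x u v => f x (u * antipode k v))
    (by constructor <;>
      simp [add_mul, mul_add, hf.add_left, hf.add_right, hf.smul_left, hf.smul_right])]
  simp only [sw_mul_antipode ⟨hf.add_right _, fun c => hf.smul_right c _⟩]
  exact sw_counit_snd_R hR (f := fun x => f x 1)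
    ⟨fun x y => hf.add_left x y 1, fun c x => hf.smul_left c x 1⟩

/-- Contracting the first two legs of `(Δ ⊗ id)(R) = R₁₃ R₂₃` shows that `(γ ⊗ id)(R)` is a right
inverse of `R`. -/
theorem sw_R_antipode_fst (hR : IsUniversalRMatrix R) {f : H → H → P} (hf : IsBilin k f) :
    (sw R fun x y => sw R fun z w => f (x * antipode k z) (y * w)) = f 1 1 := by
  rw [← sw_comul_fst_R hR (f := fun x u v => f (x * antipode k u) v)
    (by constructor <;>
      simp [add_mul, mul_add, hf.add_left, hf.add_right, hf.smul_left, hf.smul_right])]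
  simp only [sw_mul_antipode (f := fun x => f x _)
    ⟨fun x y => hf.add_left x y _, fun c x => hf.smul_left c x _⟩]
  exact sw_counit_fst_R hR (f := fun x => f 1 x)
    ⟨fun x y => hf.add_right 1 x y, fun c x => hf.smul_right c 1 x⟩

end RMatrix

end Sweedler

/-! ### Braided tensor products of module algebras. -/

section TwistedTensor

open Coalgebra

theorem actTensor_tmul {k : Type*} [CommRing k] {X Y M N : Type*}
    [AddCommGroup X] [Module k X] [AddCommGroup Y] [Module k Y]
    [AddCommGroup M] [Module k M] [AddCommGroup N] [Module k N]
    (α : X →ₗ[k] M →ₗ[k] M) (β : Y →ₗ[k] N →ₗ[k] N) (t : X ⊗[k] Y) (m : M) (n : N) :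
    actTensor α β t (m ⊗ₜ n) = sw t fun x y => α x m ⊗ₜ[k] β y n := by
  rw [apply_eq_sw (actTensor α β), sw_apply]
  rfl

variable {k : Type u} [CommRing k] {H : Type u} [Ring H] [HopfAlgebra k H] {R : H ⊗[k] H}
  {A B C : ModuleAlgebraData.{u} k H}

theorem IsModuleAlgebra.act_mul_sw (hA : IsModuleAlgebra A) (x : H) (a b : A.carrier) :
    A.act x (A.mul (a ⊗ₜ b)) =
      sw (comul (R := k) x) fun y z => A.mul (A.act y a ⊗ₜ A.act z b) := by
  rw [hA.act_mul_distrib, actTensor_tmul, map_sw]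

/-- The multiplication of the braided tensor product. -/
def twistedMul (R : H ⊗[k] H) (A B : ModuleAlgebraData.{u} k H) :
    (A.carrier ⊗[k] B.carrier) ⊗[k] (A.carrier ⊗[k] B.carrier) →ₗ[k] A.carrier ⊗[k] B.carrier :=
  (twistedTensor R A B).mul

/-- The action of `H` on the braided tensor product. -/
def twistedAct (A B : ModuleAlgebraData.{u} k H) :
    H →ₗ[k] A.carrier ⊗[k] B.carrier →ₗ[k] A.carrier ⊗[k] B.carrier :=
  actTensor A.act B.act ∘ₗ comul

theorem twistedMul_tmul (a₁ a₂ : A.carrier) (b₁ b₂ : B.carrier) :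
    twistedMul R A B ((a₁ ⊗ₜ b₁) ⊗ₜ (a₂ ⊗ₜ b₂)) =
      sw R fun x y => A.mul (a₁ ⊗ₜ A.act y a₂) ⊗ₜ B.mul (B.act x b₁ ⊗ₜ b₂) := by
  change (TensorProduct.map A.mul B.mul ∘ₗ
    (TensorProduct.tensorTensorTensorComm k A.carrier B.carrier A.carrier B.carrier).toLinearMap)
    (actTensor _ _ R _) = _
  rw [actTensor_tmul, map_sw]
  rfl

theorem twistedAct_tmul (x : H) (a : A.carrier) (b : B.carrier) :
    twistedAct A B x (a ⊗ₜ b) =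
      sw (comul (R := k) x) fun y z => A.act y a ⊗ₜ B.act z b :=
  actTensor_tmul _ _ _ _ _

/-- Acting on a product splits a leg of `R`. After the formulas for `(Δ ⊗ id)(R)` and `(id ⊗ Δ)(R)`,
both sides contain the same three copies of `R`, up to the order of summation. -/
theorem twistedMul_assoc_tmul (hR : IsUniversalRMatrix R)
    (hA : IsModuleAlgebra A) (hB : IsModuleAlgebra B) (a₁ a₂ a₃ : A.carrier) (b₁ b₂ b₃ : B.carrier) :
    twistedMul R A B (twistedMul R A B ((a₁ ⊗ₜ b₁) ⊗ₜ (a₂ ⊗ₜ b₂)) ⊗ₜ (a₃ ⊗ₜ b₃)) =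
    twistedMul R A B ((a₁ ⊗ₜ b₁) ⊗ₜ twistedMul R A B ((a₂ ⊗ₜ b₂) ⊗ₜ (a₃ ⊗ₜ b₃))) := by
  rw [twistedMul_tmul a₁, twistedMul_tmul a₂, sw_tmul_right, tmul_sw, map_sw, map_sw]
  simp only [twistedMul_tmul, hB.act_mul_sw, hA.act_mul_sw, sw_tmul_right, tmul_sw, map_sw]
  have h₁ (x y : H) := sw_comul_fst_R hR (f := fun u v w =>
    A.mul (A.mul (a₁ ⊗ₜ A.act y a₂) ⊗ₜ A.act w a₃) ⊗ₜ[k]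
      B.mul (B.mul (B.act u (B.act x b₁) ⊗ₜ B.act v b₂) ⊗ₜ b₃)) {}
  have h₂ (x y : H) := sw_comul_snd_R hR (f := fun u v w =>
    A.mul (a₁ ⊗ₜ A.mul (A.act v a₂ ⊗ₜ A.act w (A.act y a₃))) ⊗ₜ[k]
      B.mul (B.act u b₁ ⊗ₜ B.mul (B.act x b₂ ⊗ₜ b₃))) {}
  simp only [h₁, h₂]
  simp only [hA.act_mul, hB.act_mul, hA.mul_assoc, hB.mul_assoc]
  rw [sw_swap R R]
  conv_rhs => rw [sw_swap R R]
  refine sw_congr R fun x y => ?_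
  rw [sw_swap R R]

/-- Regroups `h₍₁₎ ⊗ h₍₂₎ ⊗ h₍₃₎ ⊗ h₍₄₎` so that the middle pair becomes one coproduct, to which an
R-matrix or antipode relation applies. -/
theorem sw_coassoc_four {P : Type*} [AddCommGroup P] [Module k P] {f : H → H → H → H → P}
    (hf : ∀ u, IsTrilin k (f u)) (hf' : ∀ v p q, IsLinearMap k fun u => f u v p q) (h : H) :
    (sw (comul (R := k) h) fun x y => sw (comul (R := k) x) fun u v =>
      sw (comul (R := k) y) fun p q => f u v p q) =
    sw (comul (R := k) h) fun u t => sw (comul (R := k) t) fun s q =>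
      sw (comul (R := k) s) fun v p => f u v p q := by
  have hg : IsTrilin k fun u v t => sw (comul (R := k) t) fun p q => f u v p q := by
    constructor
    · intro u u' v t
      rw [← sw_add]
      exact sw_congr _ fun p q => (hf' v p q).map_add u u'
    · intro c u v t
      rw [smul_sw]
      exact sw_congr _ fun p q => (hf' v p q).map_smul c u
    · intro u v v' t
      rw [← sw_add]
      exact sw_congr _ fun p q => (hf u).add₁ v v' p q
    · intro c u v t
      rw [smul_sw]
      exact sw_congr _ fun p q => (hf u).smul₁ c v p q
    · intro u v t t'
      simp only [← ((hf u).right v).toLin_apply, map_add]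
    · intro c u v t
      simp only [← ((hf u).right v).toLin_apply, map_smul]
  rw [sw_coassoc hg]
  exact sw_congr _ fun u t => (sw_coassoc (hf u) t).symm

/-- The outer legs of `h` act on `a₁` and `b₂` alike on both sides. The middle legs meet the
braiding, as `Δᵒᵖ R` on the left and `R Δ` on the right. -/
theorem twistedAct_mul_tmul (hR : IsUniversalRMatrix R)
    (hA : IsModuleAlgebra A) (hB : IsModuleAlgebra B) (h : H) (a₁ a₂ : A.carrier)
    (b₁ b₂ : B.carrier) :
    twistedAct A B h (twistedMul R A B ((a₁ ⊗ₜ b₁) ⊗ₜ (a₂ ⊗ₜ b₂))) =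
    twistedMul R A B (actTensor (twistedAct A B) (twistedAct A B) (comul (R := k) h)
      ((a₁ ⊗ₜ b₁) ⊗ₜ (a₂ ⊗ₜ b₂))) := by
  rw [twistedMul_tmul, actTensor_tmul]
  simp only [map_sw, twistedMul_tmul, twistedAct_tmul, hB.act_mul_sw, hA.act_mul_sw,
    sw_tmul_right, tmul_sw]
  have h₁ (x y : H) := sw_coassoc_four (k := k) (f := fun u v p q =>
    A.mul (A.act u a₁ ⊗ₜ A.act v (A.act y a₂)) ⊗ₜ[k]
      B.mul (B.act p (B.act x b₁) ⊗ₜ B.act q b₂)) (fun _ => {}) (fun _ _ _ => ⟨by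
        simp [TensorProduct.add_tmul], by simp [← TensorProduct.smul_tmul']⟩) h
  have h₂ (x y : H) := sw_coassoc_four (k := k) (f := fun u v p q =>
    A.mul (A.act u a₁ ⊗ₜ A.act y (A.act p a₂)) ⊗ₜ[k]
      B.mul (B.act x (B.act v b₁) ⊗ₜ B.act q b₂)) (fun _ => {}) (fun _ _ _ => ⟨by
        simp [TensorProduct.add_tmul], by simp [← TensorProduct.smul_tmul']⟩) h
  refine (sw_congr R fun x y => (sw_congr _ fun _ _ => sw_swap _ _ _).trans (h₁ x y)).trans ?_
  conv_rhs => simp only [sw_swap _ R]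
  refine Eq.trans ?_ (sw_congr R fun x y => (sw_congr _ fun _ _ => sw_swap _ _ _).trans
    (h₂ x y)).symm
  simp only [sw_swap R]
  refine sw_congr _ fun u t => sw_congr _ fun s q => ?_
  have e := sw_R_comul hR (f := fun x y => A.mul (A.act u a₁ ⊗ₜ A.act y a₂) ⊗ₜ[k]
    B.mul (B.act x b₁ ⊗ₜ B.act q b₂)) {} s
  simp only [hA.act_mul, hB.act_mul] at e
  rw [← e, sw_swap]

theorem IsModuleAlgebra.twistedTensor (hR : IsUniversalRMatrix R)
    (hA : IsModuleAlgebra A) (hB : IsModuleAlgebra B) :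
    IsModuleAlgebra (twistedTensor R A B) where
  mul_assoc := by
    intro (a : A.carrier ⊗[k] B.carrier) (b : A.carrier ⊗[k] B.carrier) (c : A.carrier ⊗[k] B.carrier)
    change twistedMul R A B (twistedMul R A B (a ⊗ₜ b) ⊗ₜ c) =
      twistedMul R A B (a ⊗ₜ twistedMul R A B (b ⊗ₜ c))
    induction a with
    | zero => simp
    | add a a' h h' => simp only [TensorProduct.add_tmul, map_add, h, h']
    | tmul a₁ b₁ =>
      induction b with
      | zero => simp
      | add b b' h h' => simp only [TensorProduct.add_tmul, TensorProduct.tmul_add, map_add, h, h']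
      | tmul a₂ b₂ =>
        induction c with
        | zero => simp
        | add c c' h h' => simp only [TensorProduct.tmul_add, map_add, h, h']
        | tmul a₃ b₃ => exact twistedMul_assoc_tmul hR hA hB a₁ a₂ a₃ b₁ b₂ b₃
  one_mul := by
    intro (a : A.carrier ⊗[k] B.carrier)
    change twistedMul R A B ((A.one ⊗ₜ B.one) ⊗ₜ a) = a
    induction a with
    | zero => simp
    | add a a' h h' => simp only [TensorProduct.tmul_add, map_add, h, h']
    | tmul a b =>
      rw [twistedMul_tmul]
      simp only [hA.one_mul, hB.act_unit, ← TensorProduct.smul_tmul', map_smul,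
        TensorProduct.tmul_smul, hB.one_mul]
      rw [sw_counit_fst_R hR (f := fun y => A.act y a ⊗ₜ[k] b)
        ⟨by simp [TensorProduct.add_tmul], by simp [← TensorProduct.smul_tmul']⟩, hA.act_one]
  mul_one := by
    intro (a : A.carrier ⊗[k] B.carrier)
    change twistedMul R A B (a ⊗ₜ (A.one ⊗ₜ B.one)) = a
    induction a with
    | zero => simp
    | add a a' h h' => simp only [TensorProduct.add_tmul, map_add, h, h']
    | tmul a b =>
      rw [twistedMul_tmul]
      simp only [hA.mul_one, hA.act_unit, ← TensorProduct.smul_tmul', map_smul,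
        TensorProduct.tmul_smul, hB.mul_one]
      rw [sw_counit_snd_R hR (f := fun y => a ⊗ₜ[k] B.act y b)
        ⟨by simp [TensorProduct.tmul_add], by simp⟩, hB.act_one]
  act_one := by
    intro (a : A.carrier ⊗[k] B.carrier)
    change twistedAct A B 1 a = a
    induction a with
    | zero => simp
    | add a a' h h' => simp only [map_add, h, h']
    | tmul a b => rw [twistedAct_tmul, sw_comul_one {}, hA.act_one, hB.act_one]
  act_mul := by
    intro x y (a : A.carrier ⊗[k] B.carrier)
    change twistedAct A B (x * y) a = twistedAct A B x (twistedAct A B y a)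
    induction a with
    | zero => simp
    | add a a' h h' => simp only [map_add, h, h']
    | tmul a b =>
      rw [twistedAct_tmul, twistedAct_tmul, sw_comul_mul {}, map_sw, sw_swap]
      simp only [twistedAct_tmul, hA.act_mul, hB.act_mul]
  act_mul_distrib := by
    intro h (a : A.carrier ⊗[k] B.carrier) (b : A.carrier ⊗[k] B.carrier)
    change twistedAct A B h (twistedMul R A B (a ⊗ₜ b)) =
      twistedMul R A B (actTensor (twistedAct A B) (twistedAct A B) (comul (R := k) h) (a ⊗ₜ b))
    induction a with
    | zero => simp
    | add a a' h h' => simp only [TensorProduct.add_tmul, map_add, h, h']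
    | tmul a₁ b₁ =>
      induction b with
      | zero => simp
      | add b b' h h' => simp only [TensorProduct.tmul_add, map_add, h, h']
      | tmul a₂ b₂ => exact twistedAct_mul_tmul hR hA hB h a₁ a₂ b₁ b₂
  act_unit := by
    intro x
    change twistedAct A B x (A.one ⊗ₜ B.one) = counit (R := k) x • (A.one ⊗ₜ B.one)
    rw [twistedAct_tmul]
    simp only [hA.act_unit, ← TensorProduct.smul_tmul']
    rw [sw_comul_counit_left (f := fun y => A.one ⊗ₜ[k] B.act y B.one)
      ⟨by simp [TensorProduct.tmul_add], by simp⟩, hB.act_unit, TensorProduct.tmul_smul]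

theorem isModuleAlgebra_unitAlgebra : IsModuleAlgebra (unitAlgebra k H) where
  mul_assoc a b c := mul_assoc (G := k) a b c
  one_mul a := one_mul (M := k) a
  mul_one a := mul_one (M := k) a
  act_one a := by
    change counit (R := k) (1 : H) * a = a
    simp
  act_mul x y a := by
    change counit (R := k) (x * y) * a = counit (R := k) x * (counit (R := k) y * a)
    simp [mul_assoc]
  act_mul_distrib := by
    intro h (a : k) (b : k)
    change (LinearMap.lsmul k k ∘ₗ counit) h (LinearMap.mul' k k (a ⊗ₜ b)) = LinearMap.mul' k k
      (actTensor (LinearMap.lsmul k k ∘ₗ counit) (LinearMap.lsmul k k ∘ₗ counit)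
        (comul (R := k) h) (a ⊗ₜ b))
    have e := sw_comul_counit_left (k := k) (f := fun z : H => counit (R := k) z • (a * b))
      ⟨by simp [add_mul], by simp [mul_assoc]⟩ h
    rw [actTensor_tmul, map_sw]
    refine e.symm.trans (sw_congr _ fun x y => ?_)
    simp [mul_left_comm, mul_assoc]
  act_unit x := rfl

theorem IsModuleAlgebra.twistedPower (hR : IsUniversalRMatrix R) (hA : IsModuleAlgebra A) :
    ∀ n, IsModuleAlgebra (twistedPower R A n)
  | 0 => isModuleAlgebra_unitAlgebra
  | 1 => hA
  | n + 2 => (hA.twistedPower hR (n + 1)).twistedTensor hR hA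

theorem IsModuleAlgebraHom.comp {f : A.carrier →ₗ[k] B.carrier} {g : B.carrier →ₗ[k] C.carrier}
    (hg : IsModuleAlgebraHom B C g) (hf : IsModuleAlgebraHom A B f) :
    IsModuleAlgebraHom A C (g ∘ₗ f) where
  map_one := by simp [hf.map_one, hg.map_one]
  map_mul a b := by simp [hf.map_mul, hg.map_mul]
  map_act x a := by simp [hf.map_act, hg.map_act]

/-- Equivariance is indispensable: it carries `f` past the `R₂ ▸` in the braided product. -/
theorem IsModuleAlgebraHom.map_id {f : A.carrier →ₗ[k] B.carrier}
    (hf : IsModuleAlgebraHom A B f) : IsModuleAlgebraHom (REDual.twistedTensor R A C)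
      (REDual.twistedTensor R B C) (TensorProduct.map f LinearMap.id) where
  map_one := by simp [hf.map_one]
  map_mul := by
    intro (a : A.carrier ⊗[k] C.carrier) (b : A.carrier ⊗[k] C.carrier)
    change TensorProduct.map f LinearMap.id (twistedMul R A C (a ⊗ₜ b)) =
      twistedMul R B C (TensorProduct.map f LinearMap.id a ⊗ₜ TensorProduct.map f LinearMap.id b)
    induction a with
    | zero => simp
    | add a a' h h' => simp only [TensorProduct.add_tmul, map_add, h, h']
    | tmul a₁ b₁ =>
      induction b with
      | zero => simp
      | add b b' h h' => simp only [TensorProduct.tmul_add, map_add, h, h']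
      | tmul a₂ b₂ =>
        simp only [TensorProduct.map_tmul, twistedMul_tmul, map_sw, hf.map_mul, hf.map_act,
          LinearMap.id_apply]
  map_act := by
    intro x (a : A.carrier ⊗[k] C.carrier)
    change TensorProduct.map f LinearMap.id (twistedAct A C x a) =
      twistedAct B C x (TensorProduct.map f LinearMap.id a)
    induction a with
    | zero => simp
    | add a a' h h' => simp only [map_add, h, h']
    | tmul a b =>
      simp only [TensorProduct.map_tmul, twistedAct_tmul, map_sw, hf.map_act, LinearMap.id_apply]

end TwistedTensor

/-! ### Coregular and coadjoint actions on the dual. -/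

section Coregular

open Coalgebra HopfAlgebra

variable {k : Type u} [CommRing k] {H : Type u} [Ring H] [HopfAlgebra k H]
variable {A : Type u} [Ring A] [Bialgebra k A] (p : BialgebraPairing k A H)

theorem leftCoregular_eq_sw (x : H) (a : A) :
    leftCoregular p x a = sw (comul (R := k) a) fun b c => p.form c x • b := by
  change ((TensorProduct.rid k A).toLinearMap ∘ₗ (p.form.flip x).lTensor A) (comul a) = _
  rw [apply_eq_sw ((TensorProduct.rid k A).toLinearMap ∘ₗ (p.form.flip x).lTensor A)]
  simp

theorem rightCoregular_eq_sw (x : H) (a : A) :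
    rightCoregular p x a = sw (comul (R := k) a) fun b c => p.form b x • c := by
  change ((TensorProduct.lid k A).toLinearMap ∘ₗ (p.form.flip x).rTensor A) (comul a) = _
  rw [apply_eq_sw ((TensorProduct.lid k A).toLinearMap ∘ₗ (p.form.flip x).rTensor A)]
  simp

theorem BialgebraPairing.form_mul_left (a b : A) (x : H) :
    p.form (a * b) x = sw (comul (R := k) x) fun y z => p.form a y * p.form b z := by
  rw [p.mul_left, apply_eq_sw (TensorProduct.dualDistrib k H H _)]
  simp

theorem BialgebraPairing.form_mul_right (a : A) (x y : H) :
    p.form a (x * y) = sw (comul (R := k) a) fun b c => p.form b x * p.form c y := by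
  rw [p.mul_right, apply_eq_sw (TensorProduct.dualDistrib k A A _)]
  simp

theorem comul_leftCoregular (x : H) (a : A) : comul (R := k) (leftCoregular p x a) =
    sw (comul (R := k) a) fun b c => b ⊗ₜ[k] leftCoregular p x c := by
  simp only [leftCoregular_eq_sw, map_sw, map_smul, tmul_sw]
  rw [← sw_coassoc (f := fun u v w => u ⊗ₜ[k] (p.form w x • v)) {}]
  refine sw_congr _ fun b c => ?_
  conv_lhs => rw [← sw_tmul (k := k) (comul (R := k) b)]
  simp only [smul_sw, TensorProduct.tmul_smul]

theorem comul_rightCoregular (x : H) (a : A) : comul (R := k) (rightCoregular p x a) =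
    sw (comul (R := k) a) fun b c => rightCoregular p x b ⊗ₜ[k] c := by
  simp only [rightCoregular_eq_sw, map_sw, map_smul, sw_tmul_right]
  rw [sw_coassoc (f := fun u v w => (p.form u x • v) ⊗ₜ[k] w) {}]
  refine sw_congr _ fun b c => ?_
  conv_lhs => rw [← sw_tmul (k := k) (comul (R := k) c)]
  simp only [smul_sw, TensorProduct.smul_tmul']

/-- Both sides are the sum of `⟨a₍₂₎, x⟩ f(a₍₁₎, a₍₃₎)`. -/
theorem sw_leftCoregular_tmul {P : Type*} [AddCommGroup P] [Module k P] {f : A → A → P}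
    (hf : IsBilin k f) (x : H) (a : A) :
    (sw (comul (R := k) a) fun b c => f (leftCoregular p x b) c) =
      sw (comul (R := k) a) fun b c => f b (rightCoregular p x c) := by
  have h := sw_coassoc (k := k) (f := fun u v w => p.form v x • f u w)
    (by constructor <;> simp [hf.add_left, hf.add_right, hf.smul_left, hf.smul_right, add_smul,
      smul_smul, mul_comm]) a
  simp only [leftCoregular_eq_sw, rightCoregular_eq_sw, hf.map_sw_left, hf.map_sw_right,
    hf.smul_left, hf.smul_right, h]

theorem sw_comul_leftCoregular {P : Type*} [AddCommGroup P] [Module k P] {f : A → A → P}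
    (hf : IsBilin k f) (x : H) (a : A) :
    sw (comul (R := k) (leftCoregular p x a)) f =
      sw (comul (R := k) a) fun b c => f b (leftCoregular p x c) := by
  simp only [comul_leftCoregular, sw_sw hf, sw_pure hf]

theorem sw_comul_rightCoregular {P : Type*} [AddCommGroup P] [Module k P] {f : A → A → P}
    (hf : IsBilin k f) (x : H) (a : A) :
    sw (comul (R := k) (rightCoregular p x a)) f =
      sw (comul (R := k) a) fun b c => f (rightCoregular p x b) c := by
  simp only [comul_rightCoregular, sw_sw hf, sw_pure hf]

theorem form_leftCoregular (x y : H) (a : A) :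
    p.form (leftCoregular p y a) x = p.form a (x * y) := by
  rw [leftCoregular_eq_sw, map_sw, sw_apply, p.form_mul_right]
  simp [mul_comm]

theorem form_rightCoregular (x y : H) (a : A) :
    p.form (rightCoregular p y a) x = p.form a (y * x) := by
  rw [rightCoregular_eq_sw, map_sw, sw_apply, p.form_mul_right]
  simp

theorem leftCoregular_mul (x y : H) (a : A) :
    leftCoregular p (x * y) a = leftCoregular p x (leftCoregular p y a) := by
  rw [leftCoregular_eq_sw p x, sw_comul_leftCoregular p {}, leftCoregular_eq_sw]
  simp only [form_leftCoregular]

theorem rightCoregular_mul (x y : H) (a : A) :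
    rightCoregular p (x * y) a = rightCoregular p y (rightCoregular p x a) := by
  rw [rightCoregular_eq_sw p y, sw_comul_rightCoregular p {}, rightCoregular_eq_sw]
  simp only [form_rightCoregular]

theorem leftCoregular_rightCoregular (x y : H) (a : A) :
    leftCoregular p x (rightCoregular p y a) = rightCoregular p y (leftCoregular p x a) := by
  rw [leftCoregular_eq_sw p x, sw_comul_rightCoregular p {}, leftCoregular_eq_sw, map_sw]
  simp

theorem leftCoregular_one (a : A) : leftCoregular p 1 a = a := by
  rw [leftCoregular_eq_sw]
  simp only [p.one_right]
  exact sw_comul_counit_right (f := fun b => b) ⟨fun _ _ => rfl, fun _ _ => rfl⟩ a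

theorem rightCoregular_one (a : A) : rightCoregular p 1 a = a := by
  rw [rightCoregular_eq_sw]
  simp only [p.one_right]
  exact sw_comul_counit_left (f := fun b => b) ⟨fun _ _ => rfl, fun _ _ => rfl⟩ a

theorem counit_leftCoregular (x : H) (a : A) :
    counit (R := k) (leftCoregular p x a) = p.form a x := by
  rw [← p.one_right, form_leftCoregular, one_mul]

theorem counit_rightCoregular (x : H) (a : A) :
    counit (R := k) (rightCoregular p x a) = p.form a x := by
  rw [← p.one_right, form_rightCoregular, mul_one]

theorem leftCoregular_apply_one (x : H) :
    leftCoregular p x 1 = counit (R := k) x • (1 : A) := by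
  rw [leftCoregular_eq_sw, sw_comul_one {}, p.one_left]

theorem rightCoregular_apply_one (x : H) :
    rightCoregular p x 1 = counit (R := k) x • (1 : A) := by
  rw [rightCoregular_eq_sw, sw_comul_one {}, p.one_left]

theorem leftCoregular_apply_mul (x : H) (a b : A) : leftCoregular p x (a * b) =
    sw (comul (R := k) x) fun y z => leftCoregular p y a * leftCoregular p z b := by
  rw [leftCoregular_eq_sw, sw_comul_mul {}]
  simp only [leftCoregular_eq_sw, sw_mul, mul_sw, p.form_mul_left, sw_smul]
  conv_rhs => simp only [sw_swap (comul x)]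
  rw [sw_swap]
  simp only [smul_mul_smul_comm]

theorem rightCoregular_apply_mul (x : H) (a b : A) : rightCoregular p x (a * b) =
    sw (comul (R := k) x) fun y z => rightCoregular p y a * rightCoregular p z b := by
  rw [rightCoregular_eq_sw, sw_comul_mul {}]
  simp only [rightCoregular_eq_sw, sw_mul, mul_sw, p.form_mul_left, sw_smul]
  conv_rhs => simp only [sw_swap (comul x)]
  rw [sw_swap]
  simp only [smul_mul_smul_comm]

/-- The left action `x ⊗ a ↦ a ◃ γ(x)`. -/
def antipodeAction : H →ₗ[k] A →ₗ[k] A := rightCoregular p ∘ₗ antipode k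

theorem antipodeAction_apply (x : H) (a : A) :
    antipodeAction p x a = rightCoregular p (antipode k x) a := rfl

theorem antipodeAction_mul (x y : H) (a : A) :
    antipodeAction p (x * y) a = antipodeAction p x (antipodeAction p y a) := by
  simp only [antipodeAction_apply, antipode_mul_antidistrib, rightCoregular_mul]

theorem antipodeAction_one (a : A) : antipodeAction p 1 a = a := by
  rw [antipodeAction_apply, antipode_one, rightCoregular_one]

theorem leftCoregular_antipodeAction (x y : H) (a : A) :
    leftCoregular p x (antipodeAction p y a) = antipodeAction p y (leftCoregular p x a) :=
  leftCoregular_rightCoregular p _ _ _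

theorem antipodeAction_apply_one (x : H) :
    antipodeAction p x 1 = counit (R := k) x • (1 : A) := by
  rw [antipodeAction_apply, rightCoregular_apply_one, counit_antipode]

theorem counit_antipodeAction (x : H) (a : A) :
    counit (R := k) (antipodeAction p x a) = p.form a (antipode k x) :=
  counit_rightCoregular p _ a

/-- The legs of `x` appear in reversed order because `γ` reverses the coproduct. -/
theorem antipodeAction_apply_mul (x : H) (a b : A) : antipodeAction p x (a * b) =
    sw (comul (R := k) x) fun y z => antipodeAction p z a * antipodeAction p y b := by
  rw [antipodeAction_apply, rightCoregular_apply_mul, sw_comul_antipode {}]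
  rfl

theorem sw_comul_antipodeAction {P : Type*} [AddCommGroup P] [Module k P] {f : A → A → P}
    (hf : IsBilin k f) (x : H) (a : A) :
    sw (comul (R := k) (antipodeAction p x a)) f =
      sw (comul (R := k) a) fun b c => f (antipodeAction p x b) c :=
  sw_comul_rightCoregular p hf _ a

/-- The left action `x ⊗ a ↦ x₍₂₎ ▹ a ◃ γ(x₍₁₎)`. -/
def coadjoint : H →ₗ[k] A →ₗ[k] A := biAction p ∘ₗ comul

theorem coadjoint_apply (x : H) (a : A) : coadjoint p x a =
    sw (comul (R := k) x) fun y z => leftCoregular p z (antipodeAction p y a) := by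
  change biAction p (comul x) a = _
  rw [apply_eq_sw (biAction p), sw_apply]
  rfl

theorem coadjoint_one (a : A) : coadjoint p 1 a = a := by
  rw [coadjoint_apply, sw_comul_one {}, leftCoregular_one, antipodeAction_one]

theorem coadjoint_mul (x y : H) (a : A) :
    coadjoint p (x * y) a = coadjoint p x (coadjoint p y a) := by
  rw [coadjoint_apply, sw_comul_mul {}, coadjoint_apply p x]
  simp only [coadjoint_apply p y, map_sw, leftCoregular_mul, antipodeAction_mul,
    leftCoregular_antipodeAction]

theorem coadjoint_apply_one (x : H) : coadjoint p x 1 = counit (R := k) x • (1 : A) := by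
  rw [coadjoint_apply]
  simp only [antipodeAction_apply_one, map_smul, leftCoregular_apply_one]
  exact sw_comul_counit_left (f := fun z => counit (R := k) z • (1 : A))
    ⟨by simp [add_smul], by simp [smul_smul]⟩ x

theorem coadjoint_apply_mul (x : H) (a b : A) : coadjoint p x (a * b) =
    sw (comul (R := k) x) fun u t => sw (comul (R := k) t) fun s q =>
      coadjoint p s a * leftCoregular p q (antipodeAction p u b) := by
  rw [coadjoint_apply]
  simp only [antipodeAction_apply_mul, map_sw, leftCoregular_apply_mul, coadjoint_apply, sw_mul]
  exact sw_coassoc_four (k := k) (f := fun u v y q => leftCoregular p y (antipodeAction p v a) *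
    leftCoregular p q (antipodeAction p u b)) (fun _ => {})
    (fun _ _ _ => ⟨by simp [mul_add], by simp⟩) x

/-- The left side is `⟨a, γ(x₍₁₎) x₍₂₎⟩`, and the antipode axiom collapses it. -/
theorem counit_coadjoint (x : H) (a : A) :
    counit (R := k) (coadjoint p x a) = counit (R := k) x * counit (R := k) a := by
  rw [coadjoint_apply, map_sw]
  simp only [counit_leftCoregular, antipodeAction_apply, form_rightCoregular]
  rw [sw_antipode_mul (f := p.form a) ⟨by simp, by simp⟩, p.one_right, smul_eq_mul]

theorem sw_comul_coadjoint {P : Type*} [AddCommGroup P] [Module k P] {f : A → A → P}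
    (hf : IsBilin k f) (x : H) (a : A) :
    sw (comul (R := k) (coadjoint p x a)) f = sw (comul (R := k) x) fun y z =>
      sw (comul (R := k) a) fun b c => f (antipodeAction p y b) (leftCoregular p z c) := by
  rw [coadjoint_apply, map_sw, sw_sw hf]
  refine sw_congr _ fun y z => ?_
  rw [sw_comul_leftCoregular p hf, sw_comul_antipodeAction p]
  constructor <;> simp [hf.add_left, hf.add_right, hf.smul_left, hf.smul_right]

/-- The factor `v ▹` moves from the first leg of `Δ(a)` to the second, where it joins `γ(z)` in the
product `v γ(z)` on which later cancellations act. -/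
theorem sw_coadjoint_coadjoint {P : Type*} [AddCommGroup P] [Module k P] {f : A → A → P}
    (hf : IsBilin k f) (x y : H) (a : A) :
    (sw (comul (R := k) a) fun b c => f (coadjoint p x b) (coadjoint p y c)) =
      sw (comul (R := k) x) fun u v => sw (comul (R := k) y) fun z w =>
        sw (comul (R := k) a) fun b c => f (antipodeAction p u b)
          (leftCoregular p w (rightCoregular p (v * antipode k z) c)) := by
  simp only [coadjoint_apply, hf.map_sw_left, hf.map_sw_right]
  simp only [sw_swap (comul a)]
  refine sw_congr _ fun u v => sw_congr _ fun z w => ?_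
  simp only [leftCoregular_antipodeAction p v, rightCoregular_mul]
  refine sw_leftCoregular_tmul p
    (f := fun b c => f (antipodeAction p u b) (leftCoregular p w (antipodeAction p z c))) ?_ v a
  constructor <;> simp [hf.add_left, hf.add_right, hf.smul_left, hf.smul_right]

end Coregular

/-! ### The RE dual and its coproducts. -/

section REDual

open Coalgebra HopfAlgebra

variable {k : Type u} [CommRing k] {H : Type u} [Ring H] [HopfAlgebra k H] {R : H ⊗[k] H}
variable {A : Type u} [Ring A] [Bialgebra k A] (p : BialgebraPairing k A H)

/-- The multiplication of the RE dual. -/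
def reMul (R : H ⊗[k] H) : A ⊗[k] A →ₗ[k] A :=
  LinearMap.mul' k A ∘ₗ actTensor (biAction p) (biAction p) (reCocycle R)

theorem reMul_tmul (hR : IsUniversalRMatrix R) (a b : A) :
    reMul p R (a ⊗ₜ b) = sw R fun x y => coadjoint p x a * antipodeAction p y b := by
  have h : reCocycle R = sw R fun x y => sw R fun z w =>
      (x ⊗ₜ[k] z) ⊗ₜ[k] ((y * w) ⊗ₜ[k] (1 : H)) := by
    rw [reCocycle, apply_eq_sw (Algebra.TensorProduct.map _ _) R,
      apply_eq_sw (Algebra.TensorProduct.map Algebra.TensorProduct.includeRight _) R]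
    simp only [sw_mul, mul_sw, Algebra.TensorProduct.map_tmul,
      Algebra.TensorProduct.includeRight_apply, Algebra.TensorProduct.includeLeft_apply,
      Algebra.TensorProduct.tmul_mul_tmul, one_mul, mul_one]
    rw [sw_swap]
  have h' (x y z w : H) : LinearMap.mul' k A (actTensor (biAction p) (biAction p)
      ((x ⊗ₜ[k] z) ⊗ₜ[k] ((y * w) ⊗ₜ[k] (1 : H))) (a ⊗ₜ b)) =
      leftCoregular p z (antipodeAction p x a) *
        leftCoregular p 1 (antipodeAction p (y * w) b) := rfl
  rw [reMul, h]
  simp only [LinearMap.comp_apply, map_sw, sw_apply, h', leftCoregular_one]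
  rw [← sw_comul_fst_R hR (f := fun u v w =>
    leftCoregular p v (antipodeAction p u a) * antipodeAction p w b) {}]
  simp only [coadjoint_apply, sw_mul]

theorem coadjoint_reMul (hR : IsUniversalRMatrix R) (h : H) (a b : A) :
    coadjoint p h (reMul p R (a ⊗ₜ b)) = sw (comul (R := k) h) fun x y =>
      reMul p R (coadjoint p x a ⊗ₜ coadjoint p y b) := by
  simp only [reMul_tmul p hR, map_sw, coadjoint_apply_mul]
  have h₁ (x y : H) := sw_coassoc (k := k) (f := fun u s q => coadjoint p s (coadjoint p x a) *
    leftCoregular p q (antipodeAction p u (antipodeAction p y b))) {} h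
  have h₂ (x y : H) := sw_coassoc (k := k) (f := fun u s q => coadjoint p x (coadjoint p u a) *
    antipodeAction p y (leftCoregular p q (antipodeAction p s b))) {} h
  simp only [← h₁]
  conv_rhs => simp only [coadjoint_apply p _ b, map_sw, mul_sw, sw_swap _ R]
  simp only [← h₂]
  simp only [sw_swap R]
  refine sw_congr _ fun w q => ?_
  have e := sw_R_comul hR (f := fun x y => coadjoint p x a *
    leftCoregular p q (antipodeAction p y b)) {} w
  simp only [coadjoint_mul, antipodeAction_mul] at e
  simp only [← leftCoregular_antipodeAction]
  rw [← e, sw_swap]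

theorem antipodeAction_reMul (hR : IsUniversalRMatrix R) (h : H) (a b : A) :
    antipodeAction p h (reMul p R (a ⊗ₜ b)) = sw R fun x y => sw (comul (R := k) h) fun u v =>
      antipodeAction p v (coadjoint p x a) * antipodeAction p (u * y) b := by
  simp only [reMul_tmul p hR, map_sw, antipodeAction_apply_mul, antipodeAction_mul]

/-- By equivariance of `∘` on the left, and the reversed product rule for `◃ γ` on the right, both
sides become products of actions on `a`, `b`, `c`. Splitting `R` by its coproduct formulas then
yields the same triple sum. -/
theorem reMul_assoc (hR : IsUniversalRMatrix R) (a b c : A) :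
    reMul p R (reMul p R (a ⊗ₜ b) ⊗ₜ c) = reMul p R (a ⊗ₜ reMul p R (b ⊗ₜ c)) := by
  rw [reMul_tmul p hR _ c, reMul_tmul p hR a (reMul p R (b ⊗ₜ c))]
  simp only [coadjoint_reMul p hR, antipodeAction_reMul p hR]
  simp only [reMul_tmul p hR, sw_mul, mul_sw]
  have h₁ (x y : H) := sw_comul_fst_R hR (f := fun u v w => coadjoint p x (coadjoint p u a) *
    antipodeAction p y (coadjoint p v b) * antipodeAction p w c) {}
  have h₂ (x y : H) := sw_comul_snd_R hR (f := fun u v w => coadjoint p u a *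
    (antipodeAction p w (coadjoint p x b) * antipodeAction p (v * y) c)) {}
  refine ((sw_congr R fun u w => sw_swap (comul u) R _).trans
    ((sw_swap R R _).trans (sw_congr R fun x y => h₁ x y))).trans ?_
  refine Eq.trans ?_ ((sw_swap R R _).trans (sw_congr R fun x y => h₂ x y)).symm
  simp only [coadjoint_mul, antipodeAction_mul, mul_assoc]
  conv_rhs => rw [sw_swap R R]
  refine sw_congr R fun x y => ?_
  rw [sw_swap R R]

theorem isModuleAlgebra_reDual (hR : IsUniversalRMatrix R) : IsModuleAlgebra (reDual R p) where
  mul_assoc := reMul_assoc p hR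
  one_mul := by
    intro (a : A)
    change reMul p R (1 ⊗ₜ a) = a
    rw [reMul_tmul p hR]
    simp only [coadjoint_apply_one, smul_mul_assoc, one_mul]
    rw [sw_counit_fst_R hR (f := fun y => antipodeAction p y a) ⟨by simp, by simp⟩,
      antipodeAction_one]
  mul_one := by
    intro (a : A)
    change reMul p R (a ⊗ₜ 1) = a
    rw [reMul_tmul p hR]
    simp only [antipodeAction_apply_one, mul_smul_comm, mul_one]
    rw [sw_counit_snd_R hR (f := fun y => coadjoint p y a) ⟨by simp, by simp⟩, coadjoint_one]
  act_one := coadjoint_one p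
  act_mul := coadjoint_mul p
  act_mul_distrib := by
    intro h (a : A) (b : A)
    change coadjoint p h (reMul p R (a ⊗ₜ b)) =
      reMul p R (actTensor (coadjoint p) (coadjoint p) (comul (R := k) h) (a ⊗ₜ b))
    rw [coadjoint_reMul p hR, actTensor_tmul, map_sw]
  act_unit := coadjoint_apply_one p

theorem isModuleAlgebraHom_counit (hR : IsUniversalRMatrix R) :
    IsModuleAlgebraHom (reDual R p) (unitAlgebra k H) (counit (R := k) (A := A)) where
  map_one := Bialgebra.counit_one
  map_mul := by
    intro (a : A) (b : A)
    change counit (R := k) (reMul p R (a ⊗ₜ b)) = counit (R := k) a * counit (R := k) b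
    rw [reMul_tmul p hR, map_sw]
    simp only [Bialgebra.counit_mul, counit_coadjoint, counit_antipodeAction, mul_assoc]
    -- Writing `ε(b)` as `⟨b, γ(1)⟩` exhibits the right side as the value at `1` required by
    -- `sw_counit_fst_R`.
    rw [← p.one_right b, ← antipode_one (R := k) (A := H)]
    exact sw_counit_fst_R hR (f := fun y => counit (R := k) a * p.form b (antipode k y))
      ⟨by simp [mul_add], by simp [mul_left_comm]⟩
  map_act := counit_coadjoint p

theorem sw_coassoc_mul_antipode {P : Type*} [AddCommGroup P] [Module k P] {f : H → H → H → P}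
    (hf : IsTrilin k f) (h : H) :
    (sw (comul (R := k) h) fun x y => sw (comul (R := k) x) fun u v =>
      sw (comul (R := k) y) fun z w => f u (v * antipode k z) w) =
    sw (comul (R := k) h) fun u w => f u 1 w := by
  have h₁ := sw_coassoc_four (f := fun u v z w => f u (v * antipode k z) w)
    (fun u => by constructor <;> simp [add_mul, mul_add, hf.add₂, hf.add₃, hf.smul₂, hf.smul₃])
    (fun v z w => ⟨fun u u' => hf.add₁ u u' _ _, fun c u => hf.smul₁ c u _ _⟩) h
  have h₂ (u s w : H) := sw_mul_antipode (f := fun v => f u v w)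
    ⟨fun v v' => hf.add₂ u v v' w, fun c v => hf.smul₂ c u v w⟩ s
  have h₃ (u t : H) := sw_comul_counit_left (f := fun w => f u 1 w)
    ⟨fun v v' => hf.add₃ u 1 v v', fun c v => hf.smul₃ c u 1 v⟩ t
  simp only [h₁, h₂, h₃]

/-- Used to merge the braiding with the R-matrix of the second factor's product. Moving `▹` across
`Δ(b)` and splitting the second leg of one `R` produces a pair of copies that cancels by
`sw_R_antipode_snd`. -/
theorem sw_R_coadjoint_antipodeAction (hR : IsUniversalRMatrix R) {P : Type*} [AddCommGroup P]
    [Module k P] {f : A → H → A → P} (hf : IsTrilin k f) (b : A) :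
    (sw R fun x y => sw R fun z w => sw (comul (R := k) b) fun b₁ b₂ =>
      f (coadjoint p y b₁) (z * x) (antipodeAction p w b₂)) =
    sw R fun x y => sw (comul (R := k) b) fun b₁ b₂ => f (antipodeAction p y b₁) x b₂ := by
  have h₁ (y h w) : (sw (comul (R := k) b) fun b₁ b₂ =>
      f (coadjoint p y b₁) h (antipodeAction p w b₂)) =
      sw (comul (R := k) y) fun u v => sw (comul (R := k) b) fun b₁ b₂ =>
        f (antipodeAction p u b₁) h (rightCoregular p (v * antipode k w) b₂) := by
    have h₂ (b₁ b₂ : A) : f (coadjoint p y b₁) h (antipodeAction p w b₂) =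
        sw (comul (R := k) y) fun u v =>
          f (antipodeAction p u (leftCoregular p v b₁)) h (antipodeAction p w b₂) := by
      simp only [coadjoint_apply, leftCoregular_antipodeAction]
      exact IsBilin.map_sw_left (k := k) (f := fun c d => f c h d)
        ⟨fun b b' => hf.add₁ b b' h, fun r b => hf.smul₁ r b h, fun b => hf.add₃ b h,
          fun r b => hf.smul₃ r b h⟩ _ _ _
    simp only [h₂, sw_swap (comul b)]
    refine sw_congr _ fun u v => ?_
    simp only [rightCoregular_mul]
    refine sw_leftCoregular_tmul p
      (f := fun c d => f (antipodeAction p u c) h (antipodeAction p w d)) ?_ v b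
    constructor <;> simp [hf.add₁, hf.add₃, hf.smul₁, hf.smul₃]
  have h₂ (z w : H) := sw_comul_snd_R hR (f := fun x u v => sw (comul (R := k) b) fun b₁ b₂ =>
    f (antipodeAction p u b₁) (z * x) (rightCoregular p (v * antipode k w) b₂))
    (by constructor <;> simp [hf.add₁, hf.add₂, hf.add₃, hf.smul₁, hf.smul₂, hf.smul₃, sw_add,
      smul_sw, add_mul, mul_add])
  have h₃ (x y : H) := sw_R_antipode_snd hR (f := fun h v => sw (comul (R := k) b) fun b₁ b₂ =>
    f (antipodeAction p y b₁) (h * x) (rightCoregular p v b₂))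
    (by constructor <;> simp [hf.add₂, hf.add₃, hf.smul₂, hf.smul₃, sw_add, smul_sw, add_mul])
  simp only [h₁]
  rw [sw_swap R R]
  simp only [h₂]
  refine (sw_congr R fun z w => sw_swap R R _).trans ((sw_swap R R _).trans
    (sw_congr R fun x y => ?_))
  simp only [mul_assoc, one_mul, rightCoregular_one] at h₃ ⊢
  exact h₃ x y

/-- Splitting both first legs gives four copies of `R`. The two middle ones occur as `R₁ γ(R'₁) ⊗ R₂
R'₂`, which is `1 ⊗ 1` by `sw_R_antipode_fst`. -/
theorem sw_R_coadjoint_coadjoint (hR : IsUniversalRMatrix R) {P : Type*} [AddCommGroup P]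
    [Module k P] {f : A → A → H → P} (hf : IsTrilin k f) (a : A) :
    (sw R fun x y => sw R fun z w => sw (comul (R := k) a) fun a₁ a₂ =>
      f (coadjoint p x a₁) (coadjoint p z a₂) (y * w)) =
    sw R fun x y => sw R fun z w => sw (comul (R := k) a) fun a₁ a₂ =>
      f (antipodeAction p x a₁) (leftCoregular p z a₂) (y * w) := by
  have h₁ (x z h : H) := sw_coadjoint_coadjoint p (f := fun c d => f c d h)
    ⟨fun b b' d => hf.add₁ b b' d h, fun r b d => hf.smul₁ r b d h, fun b d d' => hf.add₂ b d d' h,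
      fun r b d => hf.smul₂ r b d h⟩ x z a
  have h₂ (s t w : H) := sw_comul_fst_R hR (f := fun u v y => sw (comul (R := k) a) fun b c =>
    f (antipodeAction p u b) (leftCoregular p t (rightCoregular p (v * antipode k s) c)) (y * w))
    (by constructor <;> simp [hf.add₁, hf.add₂, hf.add₃, hf.smul₁, hf.smul₂, hf.smul₃, sw_add,
      smul_sw, add_mul])
  have h₃ (u v y : H) := sw_comul_fst_R hR (f := fun s t w => sw (comul (R := k) a) fun b c =>
    f (antipodeAction p u b) (leftCoregular p t (rightCoregular p (v * antipode k s) c))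
      (y * w))
    (by constructor <;> simp [hf.add₂, hf.add₃, hf.smul₂, hf.smul₃, sw_add, smul_sw, mul_add])
  have h₄ (x y z w : H) := sw_R_antipode_fst hR (f := fun v h => sw (comul (R := k) a) fun b c =>
    f (antipodeAction p x b) (leftCoregular p z (rightCoregular p v c)) (y * (h * w)))
    (by constructor <;> simp [hf.add₂, hf.add₃, hf.smul₂, hf.smul₃, sw_add, smul_sw, mul_add,
      add_mul])
  simp only [h₁]
  refine (sw_congr R fun x y => (sw_swap R (comul x) _).trans
    (sw_congr _ fun u v => h₃ u v y)).trans ?_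
  simp only [sw_swap (comul _) R]
  refine ((sw_swap R R _).trans (sw_congr R fun s w => (sw_swap R R _).trans
    (sw_congr R fun t w' => h₂ s t (w * w')))).trans ?_
  -- The remaining exchanges bring the cancelling pair of copies to the innermost position.
  refine (sw_congr R fun s w => (sw_congr R fun t w' => sw_swap R R _).trans
    (sw_swap R R _)).trans ((sw_swap R R _).trans ?_)
  refine (sw_congr R fun z w => (sw_congr R fun s w' => sw_swap R R _).trans
    (sw_swap R R _)).trans ((sw_swap R R _).trans (sw_congr R fun x y => ?_))
  refine (sw_congr R fun z w => sw_swap R R _).trans ((sw_swap R R _).trans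
    (sw_congr R fun z w => ?_))
  simp only [mul_assoc, one_mul, rightCoregular_one] at h₄ ⊢
  exact h₄ x y z w

theorem comul_coadjoint (h : H) (a : A) : comul (R := k) (coadjoint p h a) =
    actTensor (coadjoint p) (coadjoint p) (comul (R := k) h) (comul (R := k) a) := by
  rw [← sw_tmul (k := k) (comul (R := k) (coadjoint p h a)), sw_comul_coadjoint p {},
    apply_eq_sw (actTensor _ _ _)]
  simp only [actTensor_tmul]
  conv_rhs => rw [sw_swap]
  have e (x y : H) := sw_coadjoint_coadjoint p (f := fun b c => b ⊗ₜ[k] c) {} x y a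
  refine Eq.trans ?_ (sw_congr _ fun x y => e x y).symm
  have e' := sw_coassoc_mul_antipode (k := k) (f := fun u v w => sw (comul (R := k) a) fun b c =>
    antipodeAction p u b ⊗ₜ[k] leftCoregular p w (rightCoregular p v c)) {} h
  rw [e']
  simp only [rightCoregular_one]

/-- The braided product contains three copies of `R`. `sw_R_coadjoint_antipodeAction` reduces them
to two, and `sw_R_coadjoint_coadjoint` turns the coadjoint actions on the legs of `a` into the
one-sided actions found in `Δ(a ∘ b)`. -/
theorem comul_reMul (hR : IsUniversalRMatrix R) (a b : A) : comul (R := k) (reMul p R (a ⊗ₜ b)) =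
    twistedMul R (reDual R p) (reDual R p) (comul (R := k) a ⊗ₜ comul (R := k) b) := by
  have hr : twistedMul R (reDual R p) (reDual R p) (comul (R := k) a ⊗ₜ comul (R := k) b) =
      sw (comul (R := k) a) fun a₁ a₂ => sw (comul (R := k) b) fun b₁ b₂ => sw R fun x y =>
        reMul p R (a₁ ⊗ₜ coadjoint p y b₁) ⊗ₜ[k] reMul p R (coadjoint p x a₂ ⊗ₜ b₂) := by
    conv_lhs => rw [← sw_tmul (k := k) (comul (R := k) a), ← sw_tmul (k := k) (comul (R := k) b)]
    simp only [sw_tmul_right, tmul_sw, map_sw]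
    rw [sw_swap]
    refine sw_congr _ fun a₁ a₂ => sw_congr _ fun b₁ b₂ => ?_
    exact twistedMul_tmul (A := reDual R p) (B := reDual R p) a₁ b₁ a₂ b₂
  have hl : comul (R := k) (reMul p R (a ⊗ₜ b)) = sw R fun x y => sw R fun z w =>
      sw (comul (R := k) a) fun a₁ a₂ => sw (comul (R := k) b) fun b₁ b₂ =>
        (antipodeAction p x a₁ * antipodeAction p (y * w) b₁) ⊗ₜ[k]
          (leftCoregular p z a₂ * b₂) := by
    have h := sw_comul_fst_R hR (f := fun x z y => sw (comul (R := k) a) fun a₁ a₂ =>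
      sw (comul (R := k) b) fun b₁ b₂ => (antipodeAction p x a₁ * antipodeAction p y b₁) ⊗ₜ[k]
          (leftCoregular p z a₂ * b₂)) {}
    rw [← h, reMul_tmul p hR, map_sw]
    refine sw_congr _ fun x y => ?_
    rw [← sw_tmul (k := k) (comul (R := k) (coadjoint p x a * _)), sw_comul_mul {}]
    have e (a₁ a₂ : A) := sw_comul_antipodeAction p
      (f := fun b₁ b₂ => (a₁ * b₁) ⊗ₜ[k] (a₂ * b₂)) {} y b
    simp only [e]
    exact sw_comul_coadjoint p (f := fun a₁ a₂ => sw (comul (R := k) b) fun b₁ b₂ =>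
      (a₁ * antipodeAction p y b₁) ⊗ₜ[k] (a₂ * b₂)) {} x a
  have h₁ := sw_R_coadjoint_antipodeAction p hR (f := fun b₁ h b₂ => sw R fun z w =>
    sw (comul (R := k) a) fun a₁ a₂ => (coadjoint p z a₁ * antipodeAction p w b₁) ⊗ₜ[k]
      (coadjoint p h a₂ * b₂)) {} b
  have h₂ := sw_R_coadjoint_coadjoint p hR (f := fun a₁ a₂ y => sw (comul (R := k) b) fun b₁ b₂ =>
    (a₁ * antipodeAction p y b₁) ⊗ₜ[k] (a₂ * b₂)) {} a
  rw [hl, hr, ← h₂]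
  simp only [reMul_tmul p hR, tmul_sw, sw_tmul_right]
  conv_rhs => simp only [sw_swap (comul _) R]
  simp only [sw_swap (comul b) R, sw_swap (comul b) (comul a), coadjoint_mul] at h₁
  rw [h₁, sw_swap R R]
  simp only [antipodeAction_mul]

theorem isModuleAlgebraHom_comul (hR : IsUniversalRMatrix R) :
    IsModuleAlgebraHom (reDual R p) (twistedTensor R (reDual R p) (reDual R p))
      (comul (R := k) (A := A)) where
  map_one := Bialgebra.comul_one
  map_mul := comul_reMul p hR
  map_act := comul_coadjoint p

/-- The case `1` stands apart because the first power is the RE dual itself; from there on, each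
coproduct is a composite of two homomorphisms. -/
theorem isModuleAlgebraHom_iteratedComul (hR : IsUniversalRMatrix R) : ∀ n,
    IsModuleAlgebraHom (reDual R p) (twistedPower R (reDual R p) n) (iteratedComul R p n)
  | 0 => isModuleAlgebraHom_counit p hR
  | 1 => ⟨rfl, fun _ _ => rfl, fun _ _ => rfl⟩
  | n + 2 => (isModuleAlgebraHom_iteratedComul hR (n + 1)).map_id.comp
      (isModuleAlgebraHom_comul p hR)

end REDual

end REDual

end

theorem mainTheorem2 {k H : Type u} [CommRing k] [Ring H] [HopfAlgebra k H]
    (R : H ⊗[k] H) (hR : REDual.IsUniversalRMatrix R) (n : ℕ) :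
    (∀ [Module.Finite k H] [Module.Projective k H],
      REDual.IsModuleAlgebra (REDual.reDual R (REDual.canonicalPairing k H)) ∧
      REDual.IsModuleAlgebra
        (REDual.twistedPower R (REDual.reDual R (REDual.canonicalPairing k H)) n) ∧
      REDual.IsModuleAlgebraHom (REDual.reDual R (REDual.canonicalPairing k H))
        (REDual.twistedPower R (REDual.reDual R (REDual.canonicalPairing k H)) n)
        (REDual.iteratedComul R (REDual.canonicalPairing k H) n)) ∧
    (∀ {A : Type u} [Ring A] [Bialgebra k A] (p : REDual.BialgebraPairing k A H),
      REDual.IsModuleAlgebra (REDual.reDual R p) ∧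
      REDual.IsModuleAlgebra (REDual.twistedPower R (REDual.reDual R p) n) ∧
      REDual.IsModuleAlgebraHom (REDual.reDual R p) (REDual.twistedPower R (REDual.reDual R p) n)
        (REDual.iteratedComul R p n)) := by
  have h {A : Type u} [Ring A] [Bialgebra k A] (p : REDual.BialgebraPairing k A H) :
      REDual.IsModuleAlgebra (REDual.reDual R p) ∧
      REDual.IsModuleAlgebra (REDual.twistedPower R (REDual.reDual R p) n) ∧
      REDual.IsModuleAlgebraHom (REDual.reDual R p) (REDual.twistedPower R (REDual.reDual R p) n)
        (REDual.iteratedComul R p n) :=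
    ⟨REDual.isModuleAlgebra_reDual p hR, (REDual.isModuleAlgebra_reDual p hR).twistedPower hR n,
      REDual.isModuleAlgebraHom_iteratedComul p hR n⟩
  exact ⟨h (REDual.canonicalPairing k H), h⟩
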